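/- Let $\beta\in(0,1]$, $a\ge 0$ and $b\in(0,1)$. For $c\in\mathbb{R}$ let $f_c$ be the solution of the initial value problem $$f'''+ff''+\beta f'(f'-1)=0,\qquad f(0)=a,\quad f'(0)=b,\quad f''(0)=c,$$ on its right maximal interval of existence $[0,T_c)$, $0<T_c\le+\infty$. For $\lambda\in\{0,1\}$, a solution of $(\mathcal P_{\beta;a,b,\lambda})$ is a function $f:[0,+\infty)\to\mathbb{R}$ that satisfies $f'''+ff''+\beta f'(f'-1)=0$ on $[0,+\infty)$, $f(0)=a$, $f'(0)=b$ and $f'(t)\to\lambda$ as $t\to+\infty$. It is called concave-convex (resp. convex-concave) if there is $t_0>0$ such that $f$ is strictly concave (resp. strictly convex) on $[0,t_0]$ and strictly convex (resp. strictly concave) on $[t_0,+\infty)$. There exist $c_*<0$ and $c^*\ge a(1-b)$ such that: - $f_c$ is not defined on the whole interval $[0,+\infty)$, i.e. $T_c<+\infty$, if $c<c_*$; - $f_{c_*}$ is a concave solution of $(\mathcal P_{\beta;a,b,0})$; - $f_c$ is a concave-convex solution of $(\mathcal P_{\beta;a,b,1})$ for all $c\in(c_*,0)$; - $f_c$ is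 a convex solution of $(\mathcal P_{\beta;a,b,1})$ for all $c\in[0,c^*]$; - $f_c$ is a convex-concave solution of $(\mathcal P_{\beta;a,b,1})$ for all $c\in(c^*,+\infty)$. -/

import Mathlib

open Set Filter Topology

noncomputable section

namespace MixedConvection

/-- `f` solves `f''' + f f'' + β f' (f' - 1) = 0` on `I`, where `f₁ = f'` and `f₂ = f''` on `I`
(at an endpoint that belongs to `I`, the derivatives are one-sided). -/
structure IsSolutionOn (β : ℝ) (I : Set ℝ) (f f₁ f₂ : ℝ → ℝ) : Prop where
  hasDeriv₁ : ∀ t ∈ I, HasDerivWithinAt f (f₁ t) I t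
  hasDeriv₂ : ∀ t ∈ I, HasDerivWithinAt f₁ (f₂ t) I t
  hasDeriv₃ : ∀ t ∈ I,
    HasDerivWithinAt f₂ (-(f t * f₂ t) - β * (f₁ t * (f₁ t - 1))) I t

/-- `f` solves the equation on `[0, T)` with `f 0 = a`, `f' 0 = b`, `f'' 0 = c`. -/
def SolvesIVP (β a b c T : ℝ) (f : ℝ → ℝ) : Prop :=
  ∃ f₁ f₂ : ℝ → ℝ, IsSolutionOn β (Ico 0 T) f f₁ f₂ ∧ f 0 = a ∧ f₁ 0 = b ∧ f₂ 0 = c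

/-- The right end `T_c ∈ (0, +∞]` of the right maximal interval of existence `[0, T_c)`. -/
def maxTime (β a b c : ℝ) : EReal :=
  sSup {S : EReal | ∃ T : ℝ, 0 < T ∧ (∃ f : ℝ → ℝ, SolvesIVP β a b c T f) ∧ S = (T : EReal)}

open Classical in
/-- The maximal solution `f_c` on `[0, T_c)`: at `t ∈ [0, T_c)` it takes the value of any
solution of the initial value problem that exists beyond `t`; see `maxSol_eq`.
(The value outside `[0, T_c)` is set to `0` and carries no information.) -/
def maxSol (β a b c : ℝ) (t : ℝ) : ℝ :=
  if h : ∃ f : ℝ → ℝ, ∃ T : ℝ, 0 ≤ t ∧ t < T ∧ SolvesIVP β a b c T f then h.choose t else 0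

/-- `f` is a solution of the boundary value problem on `[0, +∞)`
with `f 0 = a`, `f' 0 = b` and `f' t → l` as `t → +∞`. -/
def SolvesBVP (β a b l : ℝ) (f : ℝ → ℝ) : Prop :=
  ∃ f₁ f₂ : ℝ → ℝ, IsSolutionOn β (Ici 0) f f₁ f₂ ∧ f 0 = a ∧ f₁ 0 = b ∧
    Tendsto f₁ atTop (𝓝 l)

/-- Concave, then convex, with a genuine change of convexity at some `t₀ > 0`. -/
def IsConcaveConvex (f : ℝ → ℝ) : Prop :=
  ∃ t₀ : ℝ, 0 < t₀ ∧ StrictConcaveOn ℝ (Icc 0 t₀) f ∧ StrictConvexOn ℝ (Ici t₀) f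

/-- Convex, then concave, with a genuine change of convexity at some `t₀ > 0`. -/
def IsConvexConcave (f : ℝ → ℝ) : Prop :=
  ∃ t₀ : ℝ, 0 < t₀ ∧ StrictConvexOn ℝ (Icc 0 t₀) f ∧ StrictConcaveOn ℝ (Ici t₀) f

/-- Two solutions of the same initial value problem agree where both are defined. -/
theorem SolvesIVP.eq {β a b c T S : ℝ} {f g : ℝ → ℝ} (hf : SolvesIVP β a b c T f)
    (hg : SolvesIVP β a b c S g) {t : ℝ} (ht0 : 0 ≤ t) (htT : t < T) (htS : t < S) :
    f t = g t := by
  obtain ⟨f₁, f₂, hf, hfa, hfb, hfc⟩ := hf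
  obtain ⟨g₁, g₂, hg, hga, hgb, hgc⟩ := hg
  let v : ℝ × ℝ × ℝ → ℝ × ℝ × ℝ :=
    fun y => (y.2.1, y.2.2, -(y.1 * y.2.2) - β * (y.2.1 * (y.2.1 - 1)))
  have key : ∀ {h h₁ h₂ : ℝ → ℝ} {R : ℝ}, IsSolutionOn β (Ico 0 R) h h₁ h₂ → t < R →
      ContinuousOn (fun s => (h s, h₁ s, h₂ s)) (Icc 0 t) ∧
      ∀ s ∈ Ico 0 t, HasDerivWithinAt (fun s => (h s, h₁ s, h₂ s))
        (v (h s, h₁ s, h₂ s)) (Ici s) s := by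
    intro h h₁ h₂ R hh hR
    have hd : ∀ s ∈ Ico 0 R, HasDerivWithinAt (fun s => (h s, h₁ s, h₂ s))
        (v (h s, h₁ s, h₂ s)) (Ico 0 R) s := fun s hs =>
      (hh.hasDeriv₁ s hs).prodMk ((hh.hasDeriv₂ s hs).prodMk (hh.hasDeriv₃ s hs))
    refine ⟨fun s hs => ?_, fun s hs => ?_⟩
    · exact ((hd s ⟨hs.1, hs.2.trans_lt hR⟩).continuousWithinAt).mono
        fun x hx => ⟨hx.1, hx.2.trans_lt hR⟩
    · refine (hd s ⟨hs.1, hs.2.trans hR⟩).mono_of_mem_nhdsWithin ?_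
      filter_upwards [Ico_mem_nhdsGE (hs.2.trans hR)] with x hx
      exact ⟨hs.1.trans hx.1, hx.2⟩
  obtain ⟨cf, df⟩ := key hf htT
  obtain ⟨cg, dg⟩ := key hg htS
  obtain ⟨r, hr⟩ := ((isCompact_Icc.image_of_continuousOn cf).union
    (isCompact_Icc.image_of_continuousOn cg)).isBounded.subset_closedBall 0
  have hv : ContDiff ℝ 1 v := by fun_prop
  obtain ⟨K, hK⟩ := hv.contDiffOn.exists_lipschitzOnWith one_ne_zero
    (convex_closedBall (0 : ℝ × ℝ × ℝ) r) (isCompact_closedBall _ _)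
  have := ODE_solution_unique_of_mem_Icc_right (v := fun _ => v)
    (s := fun _ => Metric.closedBall 0 r) (K := K) (fun _ _ => hK) cf df
    (fun s hs => hr (Or.inl ⟨s, Ico_subset_Icc_self hs, rfl⟩)) cg dg
    (fun s hs => hr (Or.inr ⟨s, Ico_subset_Icc_self hs, rfl⟩))
    (by simp [hfa, hfb, hfc, hga, hgb, hgc])
  exact congrArg Prod.fst (this ⟨ht0, le_rfl⟩)

/-- `maxSol` agrees with every solution of the initial value problem. -/
theorem maxSol_eq {β a b c T : ℝ} {f : ℝ → ℝ} (hf : SolvesIVP β a b c T f) {t : ℝ}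
    (ht0 : 0 ≤ t) (htT : t < T) : maxSol β a b c t = f t := by
  have h : ∃ f : ℝ → ℝ, ∃ T : ℝ, 0 ≤ t ∧ t < T ∧ SolvesIVP β a b c T f :=
    ⟨f, T, ht0, htT, hf⟩
  rw [maxSol, dif_pos h]
  obtain ⟨S, -, hS, hg⟩ := h.choose_spec
  exact hg.eq hf ht0 hS htT

end MixedConvection

end

/-!
Write `u = f'` and `w = f''`. Three kinds of functions of time are used throughout.

* `w + f (u - k)` has derivative `u (u - k) - β u (u - 1)`. For `k = 1` this is
  `(1 - β) u (u - 1)`, and `β ≤ 1` fixes its sign: hence `u` does not reach `1` when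
  `f''(0) ≤ a (1 - b)` (`IsIVPSolutionOn.u_lt_one`), and does not come back to `1` after having
  crossed it upwards (`IsSolutionOn.one_lt_u`). For `k` the limit of a monotone `u`, it forces
  that limit to be `1` (`IsSolutionOn.tendsto_one_of_w_nonneg`,
  `IsSolutionOn.tendsto_one_of_w_nonpos`).
* The energy `w² / 2 + β (u³ / 3 - u² / 2)` does not increase while `u ≥ 0`, so the solution is
  global unless `u` becomes negative (`exists_global_of_not_reachesNegativeU`).
* `w' = -β u (u - 1)` where `w = 0`, so `w` can cross `0` only upwards in the strip `0 < u < 1`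
  and only downwards outside it.

For `f''(0) = c < 0` there are three possibilities: `u` becomes negative, and the solution blows up
in finite time because `f` satisfies a Riccati inequality (`not_global_of_u_neg`); `w` becomes
positive, and `f` is concave-convex with `u → 1`; or neither, and `f` is concave with `u → 0`. The
first two are open conditions on `c`, by continuous dependence on `c`. For `c ≥ 0` either
`u < 1` for all time, and `f` is convex with `u → 1`, or `u` exceeds `1`, an open condition on `c`,
and `f` is convex-concave with `u → 1`.

That each of these behaviours occurs on an interval of values of `c` comes from taking `u` instead
of the time as independent variable (`IsCroccoSolution`). At equal values of `u`, the solution with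
the larger `|w|` has needed less time, so its `f` is smaller, and the equation then keeps its `|w|`
larger (`IsCroccoSolution.lt`). On concave arcs the gap between the two values of `|w|` does not
even decrease, so the third behaviour occurs for one `c < 0` only (`reachesNegativeU_of_lt`). The
bounds `cLow` and `cHigh` are the supremum of the `c < 0` for which `u` becomes negative and the
infimum of the `c ≥ 0` for which `u` exceeds `1`.
-/

noncomputable section

namespace MixedConvection

/-! ### Monotonicity and first hitting times on a compact interval -/

lemma le_of_hasDerivWithinAt_nonneg {g g' : ℝ → ℝ} {s t : ℝ} (hst : s ≤ t)
    (hg : ∀ x ∈ Icc s t, HasDerivWithinAt g (g' x) (Icc s t) x)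
    (h0 : ∀ x ∈ Ioo s t, 0 ≤ g' x) : g s ≤ g t := by
  refine monotoneOn_of_hasDerivWithinAt_nonneg (f' := g') (convex_Icc s t)
    (fun x hx => (hg x hx).continuousWithinAt) ?_ ?_ ⟨le_rfl, hst⟩ ⟨hst, le_rfl⟩ hst
  · rw [interior_Icc]
    exact fun x hx => (hg x (Ioo_subset_Icc_self hx)).mono Ioo_subset_Icc_self
  · rwa [interior_Icc]

lemma lt_of_hasDerivWithinAt_pos {g g' : ℝ → ℝ} {s t : ℝ} (hst : s < t)
    (hg : ∀ x ∈ Icc s t, HasDerivWithinAt g (g' x) (Icc s t) x)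
    (h0 : ∀ x ∈ Ioo s t, 0 < g' x) : g s < g t := by
  refine strictMonoOn_of_hasDerivWithinAt_pos (f' := g') (convex_Icc s t)
    (fun x hx => (hg x hx).continuousWithinAt) ?_ ?_ ⟨le_rfl, hst.le⟩ ⟨hst.le, le_rfl⟩ hst
  · rw [interior_Icc]
    exact fun x hx => (hg x (Ioo_subset_Icc_self hx)).mono Ioo_subset_Icc_self
  · rwa [interior_Icc]

lemma exists_first_hit {g : ℝ → ℝ} {s t k : ℝ} (hst : s ≤ t) (hg : ContinuousOn g (Icc s t))
    (hs : g s < k) (ht : k ≤ g t) :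
    ∃ σ ∈ Ioc s t, g σ = k ∧ ∀ x ∈ Ico s σ, g x < k := by
  have hcl : IsClosed (Icc s t ∩ g ⁻¹' Ici k) :=
    hg.preimage_isClosed_of_isClosed isClosed_Icc isClosed_Ici
  have hne : (Icc s t ∩ g ⁻¹' Ici k).Nonempty := ⟨t, ⟨hst, le_rfl⟩, ht⟩
  have hbd : BddBelow (Icc s t ∩ g ⁻¹' Ici k) := ⟨s, fun x hx => hx.1.1⟩
  set σ := sInf (Icc s t ∩ g ⁻¹' Ici k) with hσ
  have hmem : σ ∈ Icc s t ∩ g ⁻¹' Ici k := hcl.csInf_mem hne hbd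
  have hlt : ∀ x ∈ Ico s σ, g x < k := by
    intro x hx
    by_contra! hxk
    exact absurd (csInf_le hbd ⟨⟨hx.1, hx.2.le.trans hmem.1.2⟩, hxk⟩) (not_le.2 hx.2)
  have hsσ : s < σ := by
    rcases hmem.1.1.eq_or_lt with h | h
    · have := hmem.2
      rw [← h] at this
      exact absurd this (not_le.2 hs)
    · exact h
  refine ⟨σ, ⟨hsσ, hmem.1.2⟩, le_antisymm ?_ hmem.2, hlt⟩
  by_contra! hk
  obtain ⟨x, hx, hxk⟩ := intermediate_value_Ioo hsσ.le
    (hg.mono (Icc_subset_Icc_right hmem.1.2)) ⟨hs, hk⟩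
  exact absurd (hlt x ⟨hx.1.le, hx.2⟩) (by rw [hxk]; exact lt_irrefl _)

/-- If `x` is the first point at which `g` reaches the value `k` from below,
then the derivative of `g` there is nonnegative. -/
lemma deriv_nonneg_of_first_hit {g : ℝ → ℝ} {s t x k d : ℝ} (hsx : s < x) (hxt : x ≤ t)
    (hg : HasDerivWithinAt g d (Icc s t) x) (hx : g x = k) (hlt : ∀ y ∈ Ioo s x, g y ≤ k) :
    0 ≤ d := by
  have h1 : HasDerivWithinAt g d (Iio x) x :=
    hg.mono_of_mem_nhdsWithin (by
      filter_upwards [Ioo_mem_nhdsLT hsx] with y hy using ⟨hy.1.le, hy.2.le.trans hxt⟩)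
  rw [hasDerivWithinAt_iff_tendsto_slope' (by simp)] at h1
  refine ge_of_tendsto h1 ?_
  filter_upwards [Ioo_mem_nhdsLT hsx] with y hy
  rw [slope_def_field]
  exact div_nonneg_of_nonpos (by linarith [hlt y hy]) (by linarith [hy.2])

lemma eventually_pos_right {g : ℝ → ℝ} {s t d : ℝ} (hst : s < t)
    (hg : HasDerivWithinAt g d (Icc s t) s) (hs : g s = 0) (hd : 0 < d) :
    ∀ᶠ x in 𝓝[>] s, 0 < g x := by
  have h1 : HasDerivWithinAt g d (Ioi s) s :=
    hg.mono_of_mem_nhdsWithin (by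
      filter_upwards [Ioo_mem_nhdsGT hst] with y hy using ⟨hy.1.le, hy.2.le⟩)
  rw [hasDerivWithinAt_iff_tendsto_slope' (by simp)] at h1
  filter_upwards [h1.eventually_const_lt hd, self_mem_nhdsWithin] with y hy hys
  rw [slope_def_field, hs, sub_zero] at hy
  exact (div_pos_iff_of_pos_right (sub_pos.2 hys)).1 hy

/-- A function that starts nonnegative and has positive derivative wherever it vanishes for the
first time after the start does not come back to `0`. -/
lemma pos_of_deriv_pos_of_eq_zero {g g' : ℝ → ℝ} {s t : ℝ}
    (hg : ∀ x ∈ Icc s t, HasDerivWithinAt g (g' x) (Icc s t) x) (hs : 0 ≤ g s)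
    (h0 : ∀ x ∈ Icc s t, (∀ y ∈ Ioo s x, 0 < g y) → g x = 0 → 0 < g' x) :
    ∀ x ∈ Ioc s t, 0 < g x := by
  intro x hx
  have hst : s < t := hx.1.trans_le hx.2
  have hc : ContinuousOn g (Icc s t) := fun x hx => (hg x hx).continuousWithinAt
  have hev : ∀ᶠ y in 𝓝[>] s, 0 < g y := by
    rcases hs.eq_or_lt with h | h
    · exact eventually_pos_right hst (hg s ⟨le_rfl, hst.le⟩) h.symm
        (h0 s ⟨le_rfl, hst.le⟩ (fun y hy => absurd (hy.1.trans hy.2) (lt_irrefl _)) h.symm)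
    · have := (hc s ⟨le_rfl, hst.le⟩).eventually_const_lt h
      rw [nhdsWithin_Icc_eq_nhdsGE hst] at this
      exact nhdsWithin_mono _ Ioi_subset_Ici_self this
  by_contra! hneg
  obtain ⟨r, hr, hrpos⟩ := mem_nhdsGT_iff_exists_Ioo_subset.1 hev
  set m := min x ((s + r) / 2) with hm
  have hr' : s < r := hr
  have hsm : s < m := lt_min hx.1 (by linarith)
  have hmr : m < r := (min_le_right _ _).trans_lt (by linarith)
  have hmx : m ≤ x := min_le_left _ _
  obtain ⟨σ, hσ, hσ0, hσlt⟩ := exists_first_hit (g := fun y => -g y) (k := 0) hmx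
    ((hc.mono (Icc_subset_Icc hsm.le hx.2)).neg) (by have := hrpos ⟨hsm, hmr⟩; simpa using this)
    (by simpa using hneg)
  have hσs : s < σ := hsm.trans hσ.1
  have hpos : ∀ y ∈ Ioo s σ, 0 < g y := by
    intro y hy
    rcases lt_or_ge y m with h | h
    · exact hrpos ⟨hy.1, h.trans hmr⟩
    · simpa using hσlt y ⟨h, hy.2⟩
  have hσt : σ ∈ Icc s t := ⟨hσs.le, hσ.2.trans hx.2⟩
  have h1 := h0 σ hσt hpos (by simpa using hσ0)
  have h2 := deriv_nonneg_of_first_hit hσs hσt.2 (hg σ hσt).neg hσ0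
    (fun y hy => by simpa using (hpos y hy).le)
  linarith

/-! ### The equation as an autonomous system, and its solutions -/

/-- The vector field of the first-order system satisfied by `(f, f', f'')`. -/
def field (β : ℝ) (y : ℝ × ℝ × ℝ) : ℝ × ℝ × ℝ :=
  (y.2.1, y.2.2, -(y.1 * y.2.2) - β * (y.2.1 * (y.2.1 - 1)))

/-- `f`, with `u = f'` and `w = f''`, solves the initial value problem on `I`. -/
structure IsIVPSolutionOn (β a b c : ℝ) (I : Set ℝ) (f u w : ℝ → ℝ) : Prop where
  sol : IsSolutionOn β I f u w
  init₀ : f 0 = a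
  init₁ : u 0 = b
  init₂ : w 0 = c

lemma IsSolutionOn.mono {β : ℝ} {I J : Set ℝ} {f u w : ℝ → ℝ} (h : IsSolutionOn β I f u w)
    (hJ : J ⊆ I) : IsSolutionOn β J f u w :=
  ⟨fun t ht => (h.1 t (hJ ht)).mono hJ, fun t ht => (h.2 t (hJ ht)).mono hJ,
    fun t ht => (h.3 t (hJ ht)).mono hJ⟩

lemma IsIVPSolutionOn.mono {β a b c : ℝ} {I J : Set ℝ} {f u w : ℝ → ℝ}
    (h : IsIVPSolutionOn β a b c I f u w) (hJ : J ⊆ I) : IsIVPSolutionOn β a b c J f u w :=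
  ⟨h.sol.mono hJ, h.2, h.3, h.4⟩

lemma isSolutionOn_iff {β : ℝ} {I : Set ℝ} {f u w : ℝ → ℝ} :
    IsSolutionOn β I f u w ↔ ∀ t ∈ I, HasDerivWithinAt (fun t => (f t, u t, w t))
      (field β (f t, u t, w t)) I t := by
  refine ⟨fun h t ht => (h.1 t ht).prodMk ((h.2 t ht).prodMk (h.3 t ht)), fun h => ?_⟩
  have fst : ∀ {E F : Type} [NormedAddCommGroup E] [NormedSpace ℝ E] [NormedAddCommGroup F]
      [NormedSpace ℝ F] {Y : ℝ → E × F} {Y' : E × F} {t : ℝ}, HasDerivWithinAt Y Y' I t →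
      HasDerivWithinAt (fun s => (Y s).1) Y'.1 I t ∧
        HasDerivWithinAt (fun s => (Y s).2) Y'.2 I t := by
    intro E F _ _ _ _ Y Y' t h
    exact ⟨h.hasFDerivWithinAt.fst.hasDerivWithinAt.congr_deriv (by simp),
      h.hasFDerivWithinAt.snd.hasDerivWithinAt.congr_deriv (by simp)⟩
  exact ⟨fun t ht => (fst (h t ht)).1, fun t ht => (fst (fst (h t ht)).2).1,
    fun t ht => (fst (fst (h t ht)).2).2⟩

/-- The vector field agrees on any given ball with a bounded, globally Lipschitz one. -/
lemma exists_truncated_field (β : ℝ) {R : ℝ} (hR : 0 ≤ R) :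
    ∃ (V : ℝ × ℝ × ℝ → ℝ × ℝ × ℝ) (K L : NNReal), LipschitzWith K V ∧ (∀ y, ‖V y‖ ≤ L) ∧
      ∀ y, ‖y‖ ≤ R → V y = field β y := by
  have hv : ContDiff ℝ 1 (field β) := by unfold field; fun_prop
  obtain ⟨K, hK⟩ := hv.contDiffOn.exists_lipschitzOnWith one_ne_zero
    (convex_closedBall (0 : ℝ × ℝ × ℝ) R) (isCompact_closedBall _ _)
  obtain ⟨L, hL⟩ := (isCompact_closedBall (0 : ℝ × ℝ × ℝ) R).exists_bound_of_continuousOn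
    hv.continuous.continuousOn
  let cl : ℝ → ℝ := fun x => max (-R) (min x R)
  have hcl : LipschitzWith 1 cl := (LipschitzWith.id.min_const R).const_max (-R)
  have hcl_le : ∀ x, |cl x| ≤ R := fun x =>
    abs_le.2 ⟨le_max_left _ _, max_le (by linarith) (min_le_right _ _)⟩
  have hcl_eq : ∀ x, |x| ≤ R → cl x = x := fun x hx => by
    have := abs_le.1 hx
    simp only [cl]
    rw [min_eq_left this.2, max_eq_right this.1]
  let P : ℝ × ℝ × ℝ → ℝ × ℝ × ℝ := fun y => (cl y.1, cl y.2.1, cl y.2.2)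
  have hP : LipschitzWith 1 P := by
    have h1 : LipschitzWith (1 * 1) fun y : ℝ × ℝ × ℝ => cl y.1 := hcl.comp LipschitzWith.prod_fst
    have h2 : LipschitzWith (1 * 1) fun y : ℝ × ℝ × ℝ => cl y.2.1 :=
      hcl.comp ((LipschitzWith.prod_fst.comp LipschitzWith.prod_snd).weaken (by simp))
    have h3 : LipschitzWith (1 * 1) fun y : ℝ × ℝ × ℝ => cl y.2.2 :=
      hcl.comp ((LipschitzWith.prod_snd.comp LipschitzWith.prod_snd).weaken (by simp))
    exact (h1.prodMk (h2.prodMk h3)).weaken (by simp)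
  have hPmem : ∀ y, P y ∈ Metric.closedBall (0 : ℝ × ℝ × ℝ) R := fun y => by
    rw [mem_closedBall_zero_iff]
    exact norm_prod_le_iff.2 ⟨hcl_le _, norm_prod_le_iff.2 ⟨hcl_le _, hcl_le _⟩⟩
  refine ⟨field β ∘ P, K, L.toNNReal, ?_, fun y => ?_, fun y hy => ?_⟩
  · have := hK.comp (hP.lipschitzOnWith (s := univ)) (fun y _ => hPmem y)
    rw [lipschitzOnWith_univ] at this
    exact this.weaken (by simp)
  · exact (hL _ (hPmem y)).trans (Real.le_coe_toNNReal L)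
  · obtain ⟨h1, h2⟩ := norm_prod_le_iff.1 hy
    obtain ⟨h2, h3⟩ := norm_prod_le_iff.1 h2
    simp only [Function.comp, P]
    rw [hcl_eq _ h1, hcl_eq _ h2, hcl_eq _ h3]

lemma exists_solution_of_bounded_lipschitz {E : Type*} [NormedAddCommGroup E] [NormedSpace ℝ E]
    [CompleteSpace E] {V : E → E} {K L : NNReal} (hK : LipschitzWith K V) (hL : ∀ y, ‖V y‖ ≤ L)
    (y₀ : E) {T : ℝ} (hT : 0 ≤ T) :
    ∃ Y : ℝ → E, Y 0 = y₀ ∧ ∀ t ∈ Icc 0 T, HasDerivWithinAt Y (V (Y t)) (Icc 0 T) t := by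
  have := IsPicardLindelof.of_time_independent (tmin := 0) (tmax := T) (t₀ := ⟨0, le_rfl, hT⟩)
    (x₀ := y₀) (a := L * T.toNNReal) (r := 0) (fun y _ => hL y) hK.lipschitzOnWith
    (by simp [hT])
  exact this.exists_eq_forall_mem_Icc_hasDerivWithinAt₀

lemma dist_le_of_lipschitz {E : Type*} [NormedAddCommGroup E] [NormedSpace ℝ E]
    {V : E → E} {K : NNReal} (hK : LipschitzWith K V) {Y Z : ℝ → E} {T : ℝ}
    (hY : ∀ t ∈ Icc 0 T, HasDerivWithinAt Y (V (Y t)) (Icc 0 T) t)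
    (hZ : ∀ t ∈ Icc 0 T, HasDerivWithinAt Z (V (Z t)) (Icc 0 T) t) :
    ∀ t ∈ Icc 0 T, dist (Y t) (Z t) ≤ dist (Y 0) (Z 0) * Real.exp (K * t) := by
  have hd : ∀ {Y : ℝ → E}, (∀ t ∈ Icc 0 T, HasDerivWithinAt Y (V (Y t)) (Icc 0 T) t) →
      ∀ t ∈ Ico 0 T, HasDerivWithinAt Y (V (Y t)) (Ici t) t := fun hY t ht =>
    (hY t (Ico_subset_Icc_self ht)).mono_of_mem_nhdsWithin (by
      filter_upwards [Ico_mem_nhdsGE ht.2] with x hx using ⟨ht.1.trans hx.1, hx.2.le⟩)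
  intro t ht
  have := dist_le_of_trajectories_ODE (v := fun _ => V) (fun _ => hK)
    (fun t ht => (hY t ht).continuousWithinAt) (hd hY)
    (fun t ht => (hZ t ht).continuousWithinAt) (hd hZ) le_rfl t ht
  simpa using this

lemma IsSolutionOn.continuousOn {β : ℝ} {I : Set ℝ} {f u w : ℝ → ℝ} (h : IsSolutionOn β I f u w) :
    ContinuousOn (fun t => (f t, u t, w t)) I :=
  fun t ht => (isSolutionOn_iff.1 h t ht).continuousWithinAt

lemma IsSolutionOn.exists_norm_le {β T : ℝ} {f u w : ℝ → ℝ}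
    (h : IsSolutionOn β (Icc 0 T) f u w) :
    ∃ R, ∀ t ∈ Icc 0 T, ‖(f t, u t, w t)‖ ≤ R :=
  isCompact_Icc.exists_bound_of_continuousOn h.continuousOn

lemma IsIVPSolutionOn.eq {β a b c T S : ℝ} {f u w f' u' w' : ℝ → ℝ}
    (h : IsIVPSolutionOn β a b c (Icc 0 T) f u w)
    (h' : IsIVPSolutionOn β a b c (Icc 0 S) f' u' w') {t : ℝ} (ht : 0 ≤ t) (htT : t ≤ T)
    (htS : t ≤ S) : f t = f' t ∧ u t = u' t ∧ w t = w' t := by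
  have h1 := h.mono (Icc_subset_Icc_right htT)
  have h2 := h'.mono (Icc_subset_Icc_right htS)
  obtain ⟨R, hR⟩ := h1.sol.exists_norm_le
  obtain ⟨R', hR'⟩ := h2.sol.exists_norm_le
  have hm : 0 ≤ max R R' := ((norm_nonneg _).trans (hR 0 ⟨le_rfl, ht⟩)).trans (le_max_left _ _)
  obtain ⟨V, K, L, hK, -, hV⟩ := exists_truncated_field β hm
  have := dist_le_of_lipschitz (V := V) hK (Y := fun t => (f t, u t, w t))
    (Z := fun t => (f' t, u' t, w' t))
    (fun s hs => by
      rw [hV _ ((hR s hs).trans (le_max_left _ _))]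
      exact isSolutionOn_iff.1 h1.sol s hs)
    (fun s hs => by
      rw [hV _ ((hR' s hs).trans (le_max_right _ _))]
      exact isSolutionOn_iff.1 h2.sol s hs) t ⟨ht, le_rfl⟩
  simp only [h.init₀, h.init₁, h.init₂, h'.init₀, h'.init₁, h'.init₂, dist_self, zero_mul,
    dist_le_zero] at this
  simpa using this

/-- Continuous dependence on the initial value of `f''`. -/
lemma IsIVPSolutionOn.eventually_exists {β a b c T : ℝ} {f u w : ℝ → ℝ}
    (h : IsIVPSolutionOn β a b c (Icc 0 T) f u w) (hT : 0 ≤ T) {ε : ℝ} (hε : 0 < ε) :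
    ∀ᶠ c' in 𝓝 c, ∃ f' u' w', IsIVPSolutionOn β a b c' (Icc 0 T) f' u' w' ∧
      |u' T - u T| < ε ∧ |w' T - w T| < ε := by
  obtain ⟨R, hR⟩ := h.sol.exists_norm_le
  have hR0 : 0 ≤ R := (norm_nonneg _).trans (hR 0 ⟨le_rfl, hT⟩)
  obtain ⟨V, K, L, hK, hL, hV⟩ := exists_truncated_field β (show 0 ≤ R + 1 by linarith)
  have hYsol : ∀ t ∈ Icc 0 T, HasDerivWithinAt (fun t => (f t, u t, w t))
      (V (f t, u t, w t)) (Icc 0 T) t := fun s hs => by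
    rw [hV _ ((hR s hs).trans (by linarith))]
    exact isSolutionOn_iff.1 h.sol s hs
  have hev : ∀ᶠ c' in 𝓝 c, dist c' c * Real.exp (K * T) < min 1 ε := by
    have hcont : Continuous fun c' : ℝ => dist c' c * Real.exp (K * T) := by fun_prop
    have := hcont.tendsto c
    rw [dist_self, zero_mul] at this
    exact this.eventually_lt_const (lt_min one_pos hε)
  filter_upwards [hev] with c' hc'
  obtain ⟨Y, hY0, hY⟩ := exists_solution_of_bounded_lipschitz hK hL (a, b, c') hT
  have hdist : ∀ t ∈ Icc 0 T, dist (Y t) (f t, u t, w t) < min 1 ε := fun t ht => by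
    refine (dist_le_of_lipschitz hK hY hYsol t ht).trans_lt (lt_of_le_of_lt ?_ hc')
    have h0 : dist (Y 0) (f 0, u 0, w 0) = dist c' c := by
      rw [hY0, h.init₀, h.init₁, h.init₂]
      simp [Prod.dist_eq]
    rw [h0]
    gcongr
    exact ht.2
  have hbd : ∀ t ∈ Icc 0 T, ‖Y t‖ ≤ R + 1 := fun t ht => by
    have h1 : ‖Y t‖ ≤ ‖(f t, u t, w t)‖ + ‖Y t - (f t, u t, w t)‖ := norm_le_insert' _ _
    have h2 := (hdist t ht).trans_le (min_le_left _ _)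
    rw [dist_eq_norm] at h2
    linarith [hR t ht]
  refine ⟨fun t => (Y t).1, fun t => (Y t).2.1, fun t => (Y t).2.2,
    ⟨isSolutionOn_iff.2 fun t ht => ?_, by simp [hY0], by simp [hY0], by simp [hY0]⟩, ?_⟩
  · have := hY t ht
    rwa [hV _ (hbd t ht)] at this
  · have := (hdist T ⟨hT, le_rfl⟩).trans_le (min_le_right _ _)
    simp only [Prod.dist_eq, max_lt_iff, Real.dist_eq] at this
    exact this.2

/-- Solutions on all compact intervals `[0, T]` glue to a solution on `[0, +∞)`. -/
lemma exists_global_of_forall {β a b c : ℝ}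
    (h : ∀ T : ℝ, 0 < T → ∃ f u w, IsIVPSolutionOn β a b c (Icc 0 T) f u w) :
    ∃ f u w, IsIVPSolutionOn β a b c (Ici 0) f u w := by
  have h' : ∀ T : ℝ, ∃ f u w, 0 < T → IsIVPSolutionOn β a b c (Icc 0 T) f u w := fun T => by
    by_cases hT : 0 < T
    · obtain ⟨f, u, w, hs⟩ := h T hT
      exact ⟨f, u, w, fun _ => hs⟩
    · exact ⟨0, 0, 0, fun h => absurd h hT⟩
  choose F U W hs using h'
  have heq : ∀ t : ℝ, 0 ≤ t → ∀ s ∈ Icc 0 (t + 1), F (s + 1) s = F (t + 1) s ∧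
      U (s + 1) s = U (t + 1) s ∧ W (s + 1) s = W (t + 1) s := fun t ht s hs' =>
    (hs (s + 1) (by linarith [hs'.1])).eq (hs (t + 1) (by linarith)) hs'.1 (by linarith) hs'.2
  refine ⟨fun t => F (t + 1) t, fun t => U (t + 1) t, fun t => W (t + 1) t, ?_, ?_, ?_, ?_⟩
  · refine isSolutionOn_iff.2 fun t ht => ?_
    have ht' : (0 : ℝ) ≤ t := ht
    have h1 := isSolutionOn_iff.1 (hs (t + 1) (by linarith)).sol t ⟨ht, by linarith⟩
    have h2 := h1.congr (f₁ := fun t => (F (t + 1) t, U (t + 1) t, W (t + 1) t))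
      (fun s hs' => by obtain ⟨e1, e2, e3⟩ := heq t ht s hs'; simp only [e1, e2, e3]) rfl
    refine h2.mono_of_mem_nhdsWithin ?_
    filter_upwards [self_mem_nhdsWithin, nhdsWithin_le_nhds (Iio_mem_nhds (lt_add_one t))]
      with s h3 h4 using ⟨h3, le_of_lt h4⟩
  · exact (hs _ (by norm_num)).init₀
  · exact (hs _ (by norm_num)).init₁
  · exact (hs _ (by norm_num)).init₂

/-- An a priori bound on bounded time intervals yields a global solution. -/
lemma exists_global_of_bound {β a b c : ℝ}
    (h : ∀ T : ℝ, 0 < T → ∃ R : ℝ, ∀ t ∈ Icc 0 T, ∀ f u w,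
      IsIVPSolutionOn β a b c (Icc 0 t) f u w → ‖(f t, u t, w t)‖ ≤ R) :
    ∃ f u w, IsIVPSolutionOn β a b c (Ici 0) f u w := by
  refine exists_global_of_forall fun T hT => ?_
  obtain ⟨R₀, hR₀⟩ := h T hT
  set R := max R₀ ‖(a, b, c)‖ with hRdef
  have hR : 0 ≤ R := (norm_nonneg _).trans (le_max_right _ _)
  obtain ⟨V, K, L, hK, hL, hV⟩ := exists_truncated_field β (show 0 ≤ R + 1 by linarith)
  obtain ⟨Y, hY0, hY⟩ := exists_solution_of_bounded_lipschitz hK hL (a, b, c) hT.le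
  have hsol : ∀ t ∈ Icc 0 T, (∀ s ∈ Icc 0 t, ‖Y s‖ ≤ R + 1) →
      IsIVPSolutionOn β a b c (Icc 0 t) (fun t => (Y t).1) (fun t => (Y t).2.1)
        (fun t => (Y t).2.2) := fun t ht hb => by
    refine ⟨isSolutionOn_iff.2 fun s hs => ?_, by simp [hY0], by simp [hY0], by simp [hY0]⟩
    have := (hY s ⟨hs.1, hs.2.trans ht.2⟩).mono (Icc_subset_Icc_right ht.2)
    rwa [hV _ (hb s hs)] at this
  have hcont : ContinuousOn (fun t => ‖Y t‖) (Icc 0 T) :=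
    (show ContinuousOn Y _ from fun t ht => (hY t ht).continuousWithinAt).norm
  refine ⟨_, _, _, hsol T ⟨hT.le, le_rfl⟩ fun s hs => ?_⟩
  by_contra! hlt
  obtain ⟨σ, hσ, hσeq, hσlt⟩ := exists_first_hit (k := R + 1) hs.1
    (hcont.mono (Icc_subset_Icc_right hs.2))
    (by simp only [hY0]; linarith [le_max_right R₀ ‖(a, b, c)‖]) hlt.le
  have hσT : σ ∈ Icc 0 T := ⟨hσ.1.le, hσ.2.trans hs.2⟩
  have h1 := hR₀ σ hσT _ _ _ (hsol σ hσT fun s hs' => by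
    rcases hs'.2.eq_or_lt with h | h
    · rw [h]; exact hσeq.le
    · exact (hσlt s ⟨hs'.1, h⟩).le)
  have h2 : ‖Y σ‖ ≤ R₀ := h1
  have h3 : ‖Y σ‖ = R + 1 := hσeq
  linarith [le_max_left R₀ ‖(a, b, c)‖]

/-! ### Monotone quantities along solutions -/

section Solution

variable {β : ℝ} {I : Set ℝ} {f u w : ℝ → ℝ}

lemma IsSolutionOn.continuousOn_u (h : IsSolutionOn β I f u w) : ContinuousOn u I :=
  fun t ht => (h.hasDeriv₂ t ht).continuousWithinAt

lemma IsSolutionOn.continuousOn_w (h : IsSolutionOn β I f u w) : ContinuousOn w I :=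
  fun t ht => (h.hasDeriv₃ t ht).continuousWithinAt

/-- For `k = 1` the derivative of `f'' + f (f' - k)` is `(1 - β) f' (f' - 1)`, which has the sign
of `f' - 1` when `β ≤ 1`; the other values of `k` serve to identify limits of `f'`. -/
lemma IsSolutionOn.hasDeriv_add_mul_sub (h : IsSolutionOn β I f u w) (k : ℝ) {t : ℝ} (ht : t ∈ I) :
    HasDerivWithinAt (fun t => w t + f t * (u t - k))
      (u t * (u t - k) - β * (u t * (u t - 1))) I t :=
  ((h.hasDeriv₃ t ht).add ((h.hasDeriv₁ t ht).mul ((h.hasDeriv₂ t ht).sub_const k))).congr_deriv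
    (by ring)

lemma IsSolutionOn.hasDeriv_energy (h : IsSolutionOn β I f u w) {t : ℝ} (ht : t ∈ I) :
    HasDerivWithinAt (fun t => w t ^ 2 / 2 + β * (u t ^ 3 / 3 - u t ^ 2 / 2))
      (-(f t * w t ^ 2)) I t := by
  have h2 := h.hasDeriv₂ t ht
  have h3 := h.hasDeriv₃ t ht
  refine (((h3.pow 2).div_const 2).add ((((h2.pow 3).div_const 3).sub
    ((h2.pow 2).div_const 2)).const_mul β)).congr_deriv ?_
  simp only [Nat.cast_ofNat, Nat.reduceSub, pow_one]
  ring

lemma IsSolutionOn.le_of_u_nonneg {s t : ℝ} (h : IsSolutionOn β (Icc s t) f u w) (hst : s ≤ t)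
    (hu : ∀ x ∈ Icc s t, 0 ≤ u x) : f s ≤ f t :=
  le_of_hasDerivWithinAt_nonneg hst h.hasDeriv₁ fun x hx => hu x (Ioo_subset_Icc_self hx)

lemma IsSolutionOn.u_lt_of_w_pos {s t : ℝ} (h : IsSolutionOn β (Icc s t) f u w) (hst : s < t)
    (hw : ∀ x ∈ Ioo s t, 0 < w x) : u s < u t :=
  lt_of_hasDerivWithinAt_pos hst h.hasDeriv₂ hw

lemma IsSolutionOn.u_lt_of_w_neg {s t : ℝ} (h : IsSolutionOn β (Icc s t) f u w) (hst : s < t)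
    (hw : ∀ x ∈ Ioo s t, w x < 0) : u t < u s := by
  have := lt_of_hasDerivWithinAt_pos hst (fun x hx => (h.hasDeriv₂ x hx).neg)
    fun x hx => neg_pos.2 (hw x hx)
  simpa using this

/-- While `f' ≥ 0` the energy `f''² / 2 + β (f'³ / 3 - f'² / 2)` does not increase,
which bounds `f'` and `f''`. -/
lemma exists_bound_of_u_nonneg {β a b c : ℝ} (hβ : 0 < β) (ha : 0 ≤ a) :
    ∃ M, ∀ (t : ℝ) (f u w : ℝ → ℝ), 0 ≤ t → IsIVPSolutionOn β a b c (Icc 0 t) f u w →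
      (∀ x ∈ Icc 0 t, 0 ≤ u x) → 0 ≤ f t ∧ f t ≤ a + M * t ∧ u t ≤ M ∧ |w t| ≤ M := by
  set E := c ^ 2 / 2 + β * (b ^ 3 / 3 - b ^ 2 / 2) with hE
  set M := max ((E + 2 * β) / β) (1 + 2 * (E + 2 * β)) with hM
  have key : ∀ (t : ℝ) (f u w : ℝ → ℝ), 0 ≤ t → IsIVPSolutionOn β a b c (Icc 0 t) f u w →
      (∀ x ∈ Icc 0 t, 0 ≤ u x) → 0 ≤ f t ∧ u t ≤ M ∧ |w t| ≤ M := by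
    intro t f u w ht h hu
    have hf : ∀ x ∈ Icc 0 t, 0 ≤ f x := fun x hx => by
      have := (h.sol.mono (Icc_subset_Icc_right hx.2)).le_of_u_nonneg hx.1
        fun y hy => hu y ⟨hy.1, hy.2.trans hx.2⟩
      rw [h.init₀] at this
      linarith
    have hen := le_of_hasDerivWithinAt_nonneg ht (fun x hx => (h.sol.hasDeriv_energy hx).neg)
      fun x hx => by
        rw [neg_neg]
        exact mul_nonneg (hf x (Ioo_subset_Icc_self hx)) (sq_nonneg _)
    simp only [Pi.neg_apply, h.init₁, h.init₂] at hen
    have hut := hu t ⟨ht, le_rfl⟩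
    have hcub : u t - 2 ≤ u t ^ 3 / 3 - u t ^ 2 / 2 := by
      nlinarith [mul_nonneg hut (sq_nonneg (u t - 3 / 2)), sq_nonneg (u t - 3 / 2)]
    have hmain : w t ^ 2 / 2 + β * u t ≤ E + 2 * β := by
      have := mul_le_mul_of_nonneg_left hcub hβ.le
      linarith
    refine ⟨hf t ⟨ht, le_rfl⟩, le_max_of_le_left ?_, le_max_of_le_right ?_⟩
    · rw [le_div_iff₀ hβ]
      nlinarith [sq_nonneg (w t)]
    · have h1 : w t ^ 2 ≤ 2 * (E + 2 * β) := by nlinarith [mul_nonneg hβ.le hut]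
      rw [abs_le]
      constructor <;> nlinarith [sq_nonneg (w t - 1), sq_nonneg (w t + 1)]
  refine ⟨M, fun t f u w ht h hu => ?_⟩
  obtain ⟨h1, h2, h3⟩ := key t f u w ht h hu
  refine ⟨h1, ?_, h2, h3⟩
  have := le_of_hasDerivWithinAt_nonneg (g := fun x => M * x - f x) (g' := fun x => M * 1 - u x) ht
    (fun x hx => ((hasDerivWithinAt_id x _).const_mul M).sub (h.sol.hasDeriv₁ x hx))
    fun x hx => by
      have := (key x f u w hx.1.le (h.mono (Icc_subset_Icc_right hx.2.le))
        fun y hy => hu y ⟨hy.1, hy.2.trans hx.2.le⟩).2.1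
      linarith
  simp only [h.init₀] at this
  linarith

/-- The constant solutions `f' = 0` and `f' = 1` are not reached in finite time:
`((f' - k)² + f''²) e^{K t}` is nondecreasing for a large constant `K`. -/
lemma IsIVPSolutionOn.w_ne_zero {a b c k t : ℝ} (h : IsIVPSolutionOn β a b c (Icc 0 t) f u w)
    (hk : k = 0 ∨ k = 1) (hb : b ≠ k) (ht : 0 ≤ t) (hu : u t = k) : w t ≠ 0 := by
  intro hw
  obtain ⟨R, hR⟩ := h.sol.exists_norm_le
  have hR0 : 0 ≤ R := (norm_nonneg _).trans (hR 0 ⟨le_rfl, ht⟩)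
  set K := 1 + 2 * R + |β| * (R + 1) with hK
  have hd : ∀ x ∈ Icc 0 t, HasDerivWithinAt
      (fun x => ((u x - k) ^ 2 + w x ^ 2) * Real.exp (K * x))
      ((2 * (u x - k) * w x + 2 * w x * (-(f x * w x) - β * (u x * (u x - 1)))
        + K * ((u x - k) ^ 2 + w x ^ 2)) * Real.exp (K * x)) (Icc 0 t) x := fun x hx => by
    have h2 := h.sol.hasDeriv₂ x hx
    have h3 := h.sol.hasDeriv₃ x hx
    have he : HasDerivWithinAt (fun x => Real.exp (K * x)) (Real.exp (K * x) * (K * 1))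
        (Icc 0 t) x :=
      ((hasDerivWithinAt_id x _).const_mul K).exp
    refine ((((h2.sub_const k).pow 2).add (h3.pow 2)).mul he).congr_deriv ?_
    simp only [Nat.cast_ofNat, Nat.reduceSub, pow_one, Pi.add_apply, Pi.pow_apply]
    ring
  have hpos : ∀ x ∈ Ioo 0 t, 0 ≤ (2 * (u x - k) * w x
      + 2 * w x * (-(f x * w x) - β * (u x * (u x - 1)))
        + K * ((u x - k) ^ 2 + w x ^ 2)) * Real.exp (K * x) := fun x hx => by
    refine mul_nonneg ?_ (Real.exp_pos _).le
    obtain ⟨hf, h23⟩ := norm_prod_le_iff.1 (hR x (Ioo_subset_Icc_self hx))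
    obtain ⟨hux, hwx⟩ := norm_prod_le_iff.1 h23
    simp only [Real.norm_eq_abs] at hf hux hwx
    obtain ⟨m, hm, hmeq⟩ : ∃ m, |m| ≤ |β| * (R + 1) ∧ β * (u x * (u x - 1)) = (u x - k) * m := by
      rcases hk with rfl | rfl
      · refine ⟨β * (u x - 1), ?_, by ring⟩
        rw [abs_mul]
        gcongr
        calc |u x - 1| ≤ |u x| + |1| := abs_sub _ _
          _ ≤ R + 1 := by rw [abs_one]; linarith
      · refine ⟨β * u x, ?_, by ring⟩
        rw [abs_mul]
        gcongr
        linarith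
    rw [hmeq]
    set z := u x - k
    have e1 := abs_le.1 hm
    have e2 := abs_le.1 hf
    have hfw : 0 ≤ (R - f x) * w x ^ 2 := mul_nonneg (by linarith) (sq_nonneg _)
    have hm1 : 0 ≤ (|β| * (R + 1) - m) * (z + w x) ^ 2 := mul_nonneg (by linarith) (sq_nonneg _)
    have hm2 : 0 ≤ (|β| * (R + 1) + m) * (z - w x) ^ 2 := mul_nonneg (by linarith) (sq_nonneg _)
    have hRz : 0 ≤ R * z ^ 2 := mul_nonneg hR0 (sq_nonneg _)
    rw [hK]
    nlinarith [sq_nonneg (z + w x)]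
  have := le_of_hasDerivWithinAt_nonneg ht hd hpos
  simp only [h.init₁, hu, hw, mul_zero, sub_self] at this
  have h1 : 0 < (b - k) ^ 2 := by
    have := sub_ne_zero.2 hb
    positivity
  simp at this
  nlinarith [sq_nonneg (w 0)]

/-! ### Signs of `f''` -/

/-- In the strip `0 < f' < 1`, a nonnegative `f''` becomes and stays positive. -/
lemma IsSolutionOn.w_pos_of_u_lt_one (hβ : 0 < β) {s t : ℝ} (h : IsSolutionOn β (Icc s t) f u w)
    (hws : 0 ≤ w s) (hus : 0 < u s) (hu : ∀ x ∈ Icc s t, u x < 1) :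
    ∀ x ∈ Ioc s t, 0 < w x ∧ u s < u x := by
  have hpos : ∀ y ∈ Icc s t, (∀ x ∈ Icc s y, 0 < u x) → ∀ x ∈ Ioc s y, 0 < w x := by
    intro y hy huy
    refine pos_of_deriv_pos_of_eq_zero (h.mono (Icc_subset_Icc_right hy.2)).hasDeriv₃ hws ?_
    intro x hx _ hwx
    rw [hwx]
    nlinarith [mul_pos hβ (mul_pos (huy x hx) (sub_pos.2 (hu x ⟨hx.1, hx.2.trans hy.2⟩)))]
  have hupos : ∀ x ∈ Icc s t, 0 < u x := by
    intro x hx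
    by_contra! hneg
    obtain ⟨σ, hσ, hσ0, hσlt⟩ := exists_first_hit (g := fun y => -u y) (k := 0) hx.1
      ((h.continuousOn_u.mono (Icc_subset_Icc_right hx.2)).neg) (by simpa using hus)
      (by simpa using hneg)
    have hσt : σ ≤ t := hσ.2.trans hx.2
    have := (h.mono (Icc_subset_Icc_right hσt)).u_lt_of_w_pos hσ.1 fun y hy =>
      hpos y ⟨hy.1.le, hy.2.le.trans hσt⟩ (fun z hz => by
        simpa using hσlt z ⟨hz.1, hz.2.trans_lt hy.2⟩) y ⟨hy.1, le_rfl⟩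
    have h0 : u σ = 0 := by simpa using hσ0
    linarith
  intro x hx
  have hst : s ≤ t := hx.1.le.trans hx.2
  have hw := hpos t ⟨hst, le_rfl⟩ hupos
  exact ⟨hw x hx, (h.mono (Icc_subset_Icc_right hx.2)).u_lt_of_w_pos hx.1 fun y hy =>
    hw y ⟨hy.1, hy.2.le.trans hx.2⟩⟩

/-- Where `f' > 1` or `f' < 0`, a nonpositive `f''` becomes and stays negative. -/
lemma IsSolutionOn.w_neg_of_pos (hβ : 0 < β) {s t : ℝ} (h : IsSolutionOn β (Icc s t) f u w)
    (hws : w s ≤ 0) (hu : ∀ x ∈ Icc s t, 0 < u x * (u x - 1)) : ∀ x ∈ Ioc s t, w x < 0 := by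
  have := pos_of_deriv_pos_of_eq_zero (g := fun x => -w x)
    (fun x hx => (h.hasDeriv₃ x hx).neg) (by simpa using hws) (fun x hx _ hwx => by
      have hwx : w x = 0 := by simpa using hwx
      rw [hwx]
      nlinarith [mul_pos hβ (hu x hx)])
  intro x hx
  simpa using this x hx

/-- Once `f'` has crossed the value `1` upwards it stays above `1`, because
`f'' + f (f' - 1)` does not decrease where `f' ≥ 1`. -/
lemma IsSolutionOn.one_lt_u (hβ : β ≤ 1) {s t : ℝ} (h : IsSolutionOn β (Icc s t) f u w)
    (hus : u s = 1) (hws : 0 < w s) : ∀ x ∈ Ioc s t, 1 < u x := by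
  have := pos_of_deriv_pos_of_eq_zero (g := fun x => u x - 1)
    (fun x hx => (h.hasDeriv₂ x hx).sub_const 1) (by simp [hus]) (fun x hx hpos hux => by
      have hux : u x = 1 := by linarith
      have := le_of_hasDerivWithinAt_nonneg hx.1
        (fun y hy => (h.mono (Icc_subset_Icc_right hx.2)).hasDeriv_add_mul_sub 1 hy)
        fun y hy => by
          have := hpos y hy
          nlinarith [mul_nonneg (sub_nonneg.2 hβ) (mul_pos (by linarith : 0 < u y) this).le]
      simp only [hus, hux] at this
      linarith)
  intro x hx
  have := this x hx
  linarith

/-- If `f''(0) ≤ a (1 - b)` and `f' ≥ 0`, then `f'` does not reach `1`, because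
`f'' + f (f' - 1)` does not increase where `0 ≤ f' ≤ 1`. -/
lemma IsIVPSolutionOn.u_lt_one {a b c t : ℝ} (hβ : β ≤ 1) (hb1 : b < 1)
    (h : IsIVPSolutionOn β a b c (Icc 0 t) f u w) (hc : c ≤ a * (1 - b))
    (hu : ∀ x ∈ Icc 0 t, 0 ≤ u x) : ∀ x ∈ Icc 0 t, u x < 1 := by
  intro x hx
  by_contra! hx1
  obtain ⟨σ, hσ, hσ1, hσlt⟩ := exists_first_hit hx.1
    (h.sol.continuousOn_u.mono (Icc_subset_Icc_right hx.2)) (by rwa [h.init₁]) hx1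
  have hσt : σ ≤ t := hσ.2.trans hx.2
  have h' := h.mono (Icc_subset_Icc_right hσt)
  have h1 := deriv_nonneg_of_first_hit hσ.1 le_rfl (h'.sol.hasDeriv₂ σ ⟨hσ.1.le, le_rfl⟩) hσ1
    fun y hy => (hσlt y ⟨hy.1.le, hy.2⟩).le
  have h2 := le_of_hasDerivWithinAt_nonneg hσ.1.le
    (fun y hy => (h'.sol.hasDeriv_add_mul_sub 1 hy).neg) fun y hy => by
      have e1 := hu y ⟨hy.1.le, hy.2.le.trans hσt⟩
      have e2 := hσlt y ⟨hy.1.le, hy.2⟩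
      nlinarith [mul_nonneg (sub_nonneg.2 hβ) (mul_nonneg e1 (sub_pos.2 e2).le)]
  simp only [Pi.neg_apply, h.init₀, h.init₁, h.init₂, hσ1] at h2
  exact h'.w_ne_zero (Or.inr rfl) hb1.ne hσ.1.le hσ1 (by linarith)

/-- For `f''(0) < 0`, either `f''` stays negative, or it vanishes exactly once and
`f'` stays in `(0, 1)`. -/
lemma IsIVPSolutionOn.w_neg_or {a b c t : ℝ} (hβ : β ∈ Ioc (0 : ℝ) 1) (ha : 0 ≤ a)
    (hb : b ∈ Ioo (0 : ℝ) 1) (hc : c < 0) (h : IsIVPSolutionOn β a b c (Icc 0 t) f u w) :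
    (∀ x ∈ Icc 0 t, w x < 0) ∨
      ((∀ x ∈ Icc 0 t, 0 < u x ∧ u x < 1) ∧ ∃ τ ∈ Ioc 0 t, w τ = 0 ∧ (∀ x ∈ Ico 0 τ, w x < 0) ∧
        ∀ x ∈ Ioc τ t, 0 < w x) := by
  by_cases hall : ∀ x ∈ Icc 0 t, w x < 0
  · exact Or.inl hall
  right
  push Not at hall
  obtain ⟨r, hr, hwr⟩ := hall
  obtain ⟨τ, hτ, hτ0, hτlt⟩ := exists_first_hit hr.1
    (h.sol.continuousOn_w.mono (Icc_subset_Icc_right hr.2)) (by rwa [h.init₂]) hwr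
  have hτt : τ ≤ t := hτ.2.trans hr.2
  have hτmem : τ ∈ Icc 0 t := ⟨hτ.1.le, hτt⟩
  have h' := h.mono (Icc_subset_Icc_right hτt)
  have hd := deriv_nonneg_of_first_hit hτ.1 hτt (h.sol.hasDeriv₃ τ hτmem) hτ0
    fun y hy => (hτlt y ⟨hy.1.le, hy.2⟩).le
  have huτb : u τ < b := by
    have := h'.sol.u_lt_of_w_neg hτ.1 fun y hy => hτlt y ⟨hy.1.le, hy.2⟩
    rwa [h.init₁] at this
  have huτ : 0 < u τ := by
    have hne : u τ ≠ 0 := fun h0 => h'.w_ne_zero (Or.inl rfl) hb.1.ne' hτ.1.le h0 hτ0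
    rcases lt_or_gt_of_ne hne with hlt | hgt
    · rw [hτ0] at hd
      nlinarith [mul_pos hβ.1 (mul_pos_of_neg_of_neg hlt (show u τ - 1 < 0 by linarith))]
    · exact hgt
  have hbefore : ∀ x ∈ Icc 0 τ, 0 < u x := fun x hx => by
    rcases hx.2.eq_or_lt with h0 | h0
    · rwa [h0]
    · exact huτ.trans ((h'.sol.mono (Icc_subset_Icc_left hx.1)).u_lt_of_w_neg h0
        fun y hy => hτlt y ⟨hx.1.trans hy.1.le, hy.2⟩)
  have hc' : c ≤ a * (1 - b) := hc.le.trans (mul_nonneg ha (sub_nonneg.2 hb.2.le))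
  have hupos : ∀ x ∈ Icc 0 t, 0 < u x := by
    intro x hx
    rcases le_or_gt x τ with hxτ | hxτ
    · exact hbefore x ⟨hx.1, hxτ⟩
    by_contra! hneg
    obtain ⟨σ, hσ, hσ0, hσlt⟩ := exists_first_hit (g := fun y => -u y) (k := 0) hxτ.le
      ((h.sol.continuousOn_u.mono (Icc_subset_Icc hτ.1.le hx.2)).neg) (by simpa using huτ)
      (by simpa using hneg)
    have hσ0 : u σ = 0 := by simpa using hσ0
    have hσt : σ ≤ t := hσ.2.trans hx.2
    have hlt1 := (h.mono (Icc_subset_Icc_right hσt)).u_lt_one hβ.2 hb.2 hc' fun y hy => by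
      rcases le_or_gt y τ with hyτ | hyτ
      · exact (hbefore y ⟨hy.1, hyτ⟩).le
      · rcases hy.2.eq_or_lt with h0 | h0
        · rw [h0, hσ0]
        · have : 0 < u y := by simpa using hσlt y ⟨hyτ.le, h0⟩
          exact this.le
    have := ((h.sol.mono (Icc_subset_Icc hτ.1.le hσt)).w_pos_of_u_lt_one hβ.1 hτ0.ge huτ
      (fun y hy => hlt1 y ⟨hτ.1.le.trans hy.1, hy.2⟩) σ ⟨hσ.1, le_rfl⟩).2
    linarith
  have hlt1 := h.u_lt_one hβ.2 hb.2 hc' fun y hy => (hupos y hy).le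
  refine ⟨fun x hx => ⟨hupos x hx, hlt1 x hx⟩, τ, ⟨hτ.1, hτt⟩, hτ0, hτlt, fun x hx => ?_⟩
  exact ((h.sol.mono (Icc_subset_Icc_left hτ.1.le)).w_pos_of_u_lt_one hβ.1 hτ0.ge huτ
      (fun y hy => hlt1 y ⟨hτ.1.le.trans hy.1, hy.2⟩) x hx).1

end Solution

/-! ### Global existence and finite-time blow-up -/

/-- The solution with `f''(0) = c` exists up to some time at which `f' < 0`. -/
def ReachesNegativeU (β a b c : ℝ) : Prop :=
  ∃ t, 0 ≤ t ∧ ∃ f u w, IsIVPSolutionOn β a b c (Icc 0 t) f u w ∧ u t < 0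

/-- The solution with `f''(0) = c` exists up to some time at which `f'' > 0`. -/
def ReachesPositiveW (β a b c : ℝ) : Prop :=
  ∃ t, 0 ≤ t ∧ ∃ f u w, IsIVPSolutionOn β a b c (Icc 0 t) f u w ∧ 0 < w t

/-- The solution with `f''(0) = c` exists up to some time at which `f' > 1`. -/
def ExceedsOne (β a b c : ℝ) : Prop :=
  ∃ t, 0 ≤ t ∧ ∃ f u w, IsIVPSolutionOn β a b c (Icc 0 t) f u w ∧ 1 < u t

lemma ReachesNegativeU.eventually {β a b c : ℝ} (h : ReachesNegativeU β a b c) :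
    ∀ᶠ c' in 𝓝 c, ReachesNegativeU β a b c' := by
  obtain ⟨t, ht, f, u, w, hs, hu⟩ := h
  filter_upwards [hs.eventually_exists ht (neg_pos.2 hu)] with c' hc'
  obtain ⟨f', u', w', hs', hu', -⟩ := hc'
  exact ⟨t, ht, f', u', w', hs', by linarith [(abs_lt.1 hu').2]⟩

lemma ReachesPositiveW.eventually {β a b c : ℝ} (h : ReachesPositiveW β a b c) :
    ∀ᶠ c' in 𝓝 c, ReachesPositiveW β a b c' := by
  obtain ⟨t, ht, f, u, w, hs, hw⟩ := h
  filter_upwards [hs.eventually_exists ht hw] with c' hc'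
  obtain ⟨f', u', w', hs', -, hw'⟩ := hc'
  exact ⟨t, ht, f', u', w', hs', by linarith [(abs_lt.1 hw').1]⟩

lemma ExceedsOne.eventually {β a b c : ℝ} (h : ExceedsOne β a b c) :
    ∀ᶠ c' in 𝓝 c, ExceedsOne β a b c' := by
  obtain ⟨t, ht, f, u, w, hs, hu⟩ := h
  filter_upwards [hs.eventually_exists ht (sub_pos.2 hu)] with c' hc'
  obtain ⟨f', u', w', hs', hu', -⟩ := hc'
  exact ⟨t, ht, f', u', w', hs', by linarith [(abs_lt.1 hu').1]⟩

lemma IsIVPSolutionOn.eqOn_maxSol {β a b c : ℝ} {f u w : ℝ → ℝ}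
    (h : IsIVPSolutionOn β a b c (Ici 0) f u w) : EqOn (maxSol β a b c) f (Ici 0) := fun t ht =>
  maxSol_eq (T := t + 1) ⟨u, w, h.sol.mono fun _ hx => hx.1, h.init₀, h.init₁, h.init₂⟩ ht
    (lt_add_one t)

lemma IsIVPSolutionOn.maxSol {β a b c : ℝ} {f u w : ℝ → ℝ}
    (h : IsIVPSolutionOn β a b c (Ici 0) f u w) :
    IsIVPSolutionOn β a b c (Ici 0) (maxSol β a b c) u w := by
  have he := h.eqOn_maxSol
  refine ⟨⟨fun t ht => (h.sol.1 t ht).congr he (he ht), h.sol.2, fun t ht => ?_⟩, ?_, h.3, h.4⟩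
  · rw [he ht]
    exact h.sol.3 t ht
  · rw [he self_mem_Ici, h.init₀]

/-- Unless `f'` becomes negative, the maximal solution is global. -/
lemma exists_global_of_not_reachesNegativeU {β a b c : ℝ} (hβ : 0 < β) (ha : 0 ≤ a)
    (h : ¬ ReachesNegativeU β a b c) :
    ∃ u w, IsIVPSolutionOn β a b c (Ici 0) (maxSol β a b c) u w ∧
      ∀ t, 0 ≤ t → 0 ≤ maxSol β a b c t ∧ 0 ≤ u t := by
  have hu : ∀ (t : ℝ) (f u w : ℝ → ℝ), IsIVPSolutionOn β a b c (Icc 0 t) f u w →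
      ∀ x ∈ Icc 0 t, 0 ≤ u x := by
    intro t f u w hs x hx
    by_contra! hneg
    exact h ⟨x, hx.1, f, u, w, hs.mono (Icc_subset_Icc_right hx.2), hneg⟩
  obtain ⟨M, hM⟩ := exists_bound_of_u_nonneg (b := b) (c := c) hβ ha
  obtain ⟨f, u, w, hs⟩ : ∃ f u w, IsIVPSolutionOn β a b c (Ici 0) f u w := by
    refine exists_global_of_bound fun T hT => ⟨a + |M| * T + |M|, fun t ht f u w hs => ?_⟩
    have hux := hu t f u w hs
    obtain ⟨h1, h2, h3, h4⟩ := hM t f u w ht.1 hs hux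
    have h5 := hux t ⟨ht.1, le_rfl⟩
    have h6 : M * t ≤ |M| * T := mul_le_mul (le_abs_self M) ht.2 ht.1 (abs_nonneg M)
    have h7 : 0 ≤ |M| * T := mul_nonneg (abs_nonneg M) hT.le
    have h8 := le_abs_self M
    refine norm_prod_le_iff.2 ⟨?_, norm_prod_le_iff.2 ⟨?_, ?_⟩⟩ <;> simp only [Real.norm_eq_abs]
    · rw [abs_of_nonneg h1]; linarith [abs_nonneg M]
    · rw [abs_of_nonneg h5]; linarith
    · linarith
  refine ⟨u, w, hs.maxSol, fun t ht => ?_⟩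
  have hst := hs.maxSol.mono (Icc_subset_Ici_self : Icc 0 t ⊆ Ici 0)
  have hux := hu t _ u w hst
  exact ⟨(hM t _ u w ht hst hux).1, hux t ⟨ht, le_rfl⟩⟩

lemma exists_global_of_maxTime_eq_top {β a b c : ℝ} (h : maxTime β a b c = ⊤) :
    ∃ f u w, IsIVPSolutionOn β a b c (Ici 0) f u w := by
  refine exists_global_of_forall fun T hT => ?_
  have hlt : (T : EReal) < maxTime β a b c := by rw [h]; exact EReal.coe_lt_top T
  obtain ⟨S, ⟨T', hT', ⟨f, u, w, hs, h0, h1, h2⟩, rfl⟩, hS⟩ := lt_sSup_iff.1 hlt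
  have hTT' : T < T' := EReal.coe_lt_coe_iff.1 hS
  exact ⟨f, u, w, hs.mono fun x hx => ⟨hx.1, hx.2.trans_lt hTT'⟩, h0, h1, h2⟩

/-- A function with derivative at least `k` grows at least with slope `k`. -/
lemma add_mul_le_of_deriv_ge {g g' : ℝ → ℝ} {s k : ℝ}
    (hg : ∀ x, s ≤ x → HasDerivWithinAt g (g' x) (Ici s) x) (hk : ∀ x, s ≤ x → k ≤ g' x)
    {x : ℝ} (hx : s ≤ x) : g s + k * (x - s) ≤ g x := by
  have := le_of_hasDerivWithinAt_nonneg (g := fun y => g y - k * y) (g' := fun y => g' y - k * 1) hx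
    (fun y hy => ((hg y hy.1).mono Icc_subset_Ici_self).sub ((hasDerivWithinAt_id y _).const_mul k))
    fun y hy => by linarith [hk y hy.1.le]
  linarith

lemma tendsto_atTop_of_deriv_ge {g g' : ℝ → ℝ} {s k : ℝ} (hk0 : 0 < k)
    (hg : ∀ x, s ≤ x → HasDerivWithinAt g (g' x) (Ici s) x) (hk : ∀ x, s ≤ x → k ≤ g' x) :
    Tendsto g atTop atTop := by
  have h1 : Tendsto (fun x => g s + k * (x - s)) atTop atTop :=
    tendsto_atTop_add_const_left _ _
      ((tendsto_atTop_add_const_right _ _ tendsto_id).const_mul_atTop hk0)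
  refine tendsto_atTop_mono' _ ?_ h1
  filter_upwards [eventually_ge_atTop s] with x hx using add_mul_le_of_deriv_ge hg hk hx

/-- There is no global solution that is eventually below `f' = -δ` with `f'' < 0`: then
`f → -∞`, and integrating twice gives the Riccati inequality `f' ≤ D - β f² / 2`. -/
lemma not_global_of_u_neg {β s δ : ℝ} {f u w : ℝ → ℝ} (hβ : β ∈ Ioc (0 : ℝ) 1) (hs : 0 ≤ s)
    (h : IsSolutionOn β (Ici 0) f u w) (hδ : 0 < δ) (hu : ∀ x, s ≤ x → u x ≤ -δ)
    (hw : ∀ x, s ≤ x → w x < 0) : False := by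
  have hsub : ∀ {r : ℝ}, s ≤ r → Ici r ⊆ Ici 0 := fun hr => Ici_subset_Ici.2 (hs.trans hr)
  have hf : Tendsto (fun x => -f x) atTop atTop :=
    tendsto_atTop_of_deriv_ge (s := s) hδ
      (fun x hx => ((h.1 x (hs.trans hx)).mono (hsub le_rfl)).neg)
      fun x hx => by linarith [hu x hx]
  have hlarge : ∀ M, ∃ r, s ≤ r ∧ ∀ x, r ≤ x → M ≤ -f x := fun M => by
    obtain ⟨r, hr⟩ := (hf.eventually_ge_atTop M).exists_forall_of_atTop
    exact ⟨max r s, le_max_right _ _, fun x hx => hr x ((le_max_left _ _).trans hx)⟩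
  obtain ⟨t₁, hst₁, ht₁⟩ := hlarge 0
  -- `f'' + β f f' - β f` has derivative `-(1 - β) f f'' ≤ 0` once `f ≤ 0`.
  have hQ : ∀ x, t₁ ≤ x → w x + β * (f x * u x) - β * f x
      ≤ w t₁ + β * (f t₁ * u t₁) - β * f t₁ := fun x hx => by
    have := le_of_hasDerivWithinAt_nonneg
      (g := fun y => -(w y + β * (f y * u y) - β * f y))
      (g' := fun y => (1 - β) * (f y * w y)) hx (fun y hy => by
        have hy0 : y ∈ Ici (0 : ℝ) := (hs.trans hst₁).trans hy.1
        have := (((h.3 y hy0).add (((h.1 y hy0).mul (h.2 y hy0)).const_mul β)).sub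
          ((h.1 y hy0).const_mul β)).neg
        exact (this.mono (Icc_subset_Ici_self.trans (hsub hst₁))).congr_deriv (by ring))
      fun y hy => mul_nonneg (sub_nonneg.2 hβ.2) (mul_nonneg_of_nonpos_of_nonpos
        (by linarith [ht₁ y hy.1.le]) (hw y (hst₁.trans hy.1.le)).le)
    linarith
  set C := w t₁ + β * (f t₁ * u t₁) - β * f t₁
  obtain ⟨t₂, hst₂, ht₂⟩ := hlarge (C / β)
  set r := max t₁ t₂
  have hr1 : t₁ ≤ r := le_max_left _ _
  have hr2 : t₂ ≤ r := le_max_right _ _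
  have hR : ∀ x, r ≤ x → u x + β * f x ^ 2 / 2 ≤ u r + β * f r ^ 2 / 2 := fun x hx => by
    have := le_of_hasDerivWithinAt_nonneg
      (g := fun y => -(u y + β * f y ^ 2 / 2))
      (g' := fun y => -(w y + β * (f y * u y))) hx (fun y hy => by
        have hy0 : y ∈ Ici (0 : ℝ) := (hs.trans (hst₁.trans hr1)).trans hy.1
        have := ((h.2 y hy0).add ((((h.1 y hy0).pow 2).const_mul β).div_const 2)).neg
        refine (this.mono (Icc_subset_Ici_self.trans (hsub (hst₁.trans hr1)))).congr_deriv ?_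
        simp only [Nat.cast_ofNat, Nat.reduceSub, pow_one]
        ring)
      fun y hy => by
        have h1 := hQ y (hr1.trans hy.1.le)
        have h2 := ht₂ y (hr2.trans hy.1.le)
        rw [div_le_iff₀ hβ.1] at h2
        linarith
    linarith
  set D := u r + β * f r ^ 2 / 2
  obtain ⟨t₃, hst₃, ht₃⟩ := hlarge (1 + 4 * |D| / β)
  set q := max r t₃
  have hq1 : r ≤ q := le_max_left _ _
  have hq3 : t₃ ≤ q := le_max_right _ _
  have hq0 : 0 ≤ q := hs.trans (hst₃.trans hq3)
  -- Beyond `q` the constant `D` is absorbed: `f' ≤ -β f² / 4`, so `1 / f` grows linearly.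
  have hbig : ∀ x, q ≤ x → f x < 0 ∧ u x ≤ -(β / 4 * f x ^ 2) := fun x hx => by
    have h1 := ht₃ x (hq3.trans hx)
    have h2 := hR x (hq1.trans hx)
    have h3 : 0 ≤ 4 * |D| / β := by have := hβ.1; positivity
    have h4 : 4 * |D| / β ≤ f x ^ 2 := by nlinarith
    rw [div_le_iff₀ hβ.1] at h4
    exact ⟨by linarith, by linarith [le_abs_self D]⟩
  have hinv : Tendsto (fun x => (f x)⁻¹) atTop atTop :=
    tendsto_atTop_of_deriv_ge (s := q) (k := β / 4) (by linarith [hβ.1])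
      (fun x hx => ((h.1 x (hq0.trans hx)).mono (Ici_subset_Ici.2 hq0)).inv (hbig x hx).1.ne)
      fun x hx => by
        have := hbig x hx
        rw [le_div_iff₀ (by have := this.1.ne; positivity)]
        linarith
  obtain ⟨x, hx, hxq⟩ := ((hinv.eventually_ge_atTop 0).and (eventually_ge_atTop q)).exists
  exact absurd (inv_lt_zero.2 (hbig x hxq).1) (not_lt.2 hx)

/-- If `f''(0) < 0` then `f'` and `f''` cannot change sign both. -/
lemma ReachesNegativeU.w_neg {β a b c : ℝ} (hβ : β ∈ Ioc (0 : ℝ) 1) (ha : 0 ≤ a)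
    (hb : b ∈ Ioo (0 : ℝ) 1) (hc : c < 0) (h : ReachesNegativeU β a b c) {t : ℝ} {f u w : ℝ → ℝ}
    (hs : IsIVPSolutionOn β a b c (Icc 0 t) f u w) : ∀ x ∈ Icc 0 t, w x < 0 := by
  obtain ⟨r, hr, f', u', w', hs', hu'⟩ := h
  have hw' : ∀ x ∈ Icc 0 r, w' x < 0 := by
    rcases hs'.w_neg_or hβ ha hb hc with h | h
    · exact h
    · exact absurd (h.1 r ⟨hr, le_rfl⟩).1 (not_lt.2 hu'.le)
  rcases le_or_gt t r with htr | htr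
  · intro x hx
    rw [(hs.eq hs' hx.1 hx.2 (hx.2.trans htr)).2.2]
    exact hw' x ⟨hx.1, hx.2.trans htr⟩
  · rcases hs.w_neg_or hβ ha hb hc with h | h
    · exact h
    · have := (h.1 r ⟨hr, htr.le⟩).1
      rw [(hs.eq hs' hr htr.le le_rfl).2.1] at this
      exact absurd this (not_lt.2 hu'.le)

lemma ReachesNegativeU.not_reachesPositiveW {β a b c : ℝ} (hβ : β ∈ Ioc (0 : ℝ) 1) (ha : 0 ≤ a)
    (hb : b ∈ Ioo (0 : ℝ) 1) (hc : c < 0) (h : ReachesNegativeU β a b c) :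
    ¬ ReachesPositiveW β a b c := by
  rintro ⟨t, ht, f, u, w, hs, hw⟩
  exact absurd (h.w_neg hβ ha hb hc hs t ⟨ht, le_rfl⟩) (not_lt.2 hw.le)

lemma ReachesNegativeU.maxTime_lt_top {β a b c : ℝ} (hβ : β ∈ Ioc (0 : ℝ) 1) (ha : 0 ≤ a)
    (hb : b ∈ Ioo (0 : ℝ) 1) (hc : c < 0) (h : ReachesNegativeU β a b c) :
    maxTime β a b c < ⊤ := by
  rw [lt_top_iff_ne_top]
  intro htop
  obtain ⟨f, u, w, hs⟩ := exists_global_of_maxTime_eq_top htop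
  have hw : ∀ x, 0 ≤ x → w x < 0 := fun x hx =>
    h.w_neg hβ ha hb hc (hs.mono (Icc_subset_Ici_self : Icc 0 x ⊆ _)) x ⟨hx, le_rfl⟩
  obtain ⟨r, hr, f', u', w', hs', hu'⟩ := h
  rw [← ((hs.mono (Icc_subset_Ici_self : Icc 0 r ⊆ _)).eq hs' hr le_rfl le_rfl).2.1] at hu'
  refine not_global_of_u_neg hβ hr hs.sol (neg_pos.2 hu') (fun x hx => ?_)
    fun x hx => hw x (hr.trans hx)
  rw [neg_neg]
  rcases hx.eq_or_lt with h | h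
  · rw [h]
  · exact ((hs.sol.mono (Icc_subset_Ici_self.trans (Ici_subset_Ici.2 hr))).u_lt_of_w_neg h
      fun y hy => hw y (hr.trans hy.1.le)).le

/-! ### Limits of `f'` at infinity -/

lemma exists_tendsto_of_deriv_nonneg {g g' : ℝ → ℝ} {s M : ℝ}
    (hg : ∀ x, s ≤ x → HasDerivWithinAt g (g' x) (Ici s) x) (h0 : ∀ x, s ≤ x → 0 ≤ g' x)
    (hM : ∀ x, s ≤ x → g x ≤ M) :
    ∃ l ≤ M, Tendsto g atTop (𝓝 l) ∧ ∀ x, s ≤ x → g x ≤ l := by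
  have hmono : ∀ x y, s ≤ x → x ≤ y → g x ≤ g y := fun x y hx hxy =>
    le_of_hasDerivWithinAt_nonneg hxy
      (fun z hz => (hg z (hx.trans hz.1)).mono (Icc_subset_Ici_self.trans (Ici_subset_Ici.2 hx)))
      fun z hz => h0 z (hx.trans hz.1.le)
  have hmono' : Monotone fun x => g (max x s) := fun x y hxy =>
    hmono _ _ (le_max_right _ _) (max_le_max_right s hxy)
  have hbdd : BddAbove (range fun x => g (max x s)) :=
    ⟨M, by rintro _ ⟨x, rfl⟩; exact hM _ (le_max_right _ _)⟩
  have ht := tendsto_atTop_ciSup hmono' hbdd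
  refine ⟨_, ciSup_le fun x => hM _ (le_max_right _ _), ht.congr' ?_, fun x hx => ?_⟩
  · filter_upwards [eventually_ge_atTop s] with x hx
    rw [max_eq_left hx]
  · have := le_ciSup hbdd x
    simpa [max_eq_left hx] using this

lemma tendsto_atTop_of_eventually_deriv_ge {g g' : ℝ → ℝ} {s k : ℝ} (hk0 : 0 < k)
    (hg : ∀ x, s ≤ x → HasDerivWithinAt g (g' x) (Ici s) x) (hk : ∀ᶠ x in atTop, k ≤ g' x) :
    Tendsto g atTop atTop := by
  obtain ⟨r, hr⟩ := hk.exists_forall_of_atTop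
  exact tendsto_atTop_of_deriv_ge (s := max r s) hk0
    (fun x hx => (hg x ((le_max_right _ _).trans hx)).mono (Ici_subset_Ici.2 (le_max_right _ _)))
    fun x hx => hr x ((le_max_left _ _).trans hx)

lemma IsSolutionOn.not_tendsto_w_atTop {β l : ℝ} {f u w : ℝ → ℝ}
    (h : IsSolutionOn β (Ici 0) f u w) (hu : Tendsto u atTop (𝓝 l)) : ¬ Tendsto w atTop atTop :=
  fun hw => not_tendsto_nhds_of_tendsto_atTop
    (tendsto_atTop_of_eventually_deriv_ge one_pos h.hasDeriv₂ (hw.eventually_ge_atTop 1)) l hu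

lemma IsSolutionOn.not_tendsto_w_atBot {β l : ℝ} {f u w : ℝ → ℝ}
    (h : IsSolutionOn β (Ici 0) f u w) (hu : Tendsto u atTop (𝓝 l)) : ¬ Tendsto w atTop atBot :=
  fun hw => not_tendsto_nhds_of_tendsto_atTop
    (tendsto_atTop_of_eventually_deriv_ge one_pos (fun x hx => (h.hasDeriv₂ x hx).neg)
      ((tendsto_neg_atBot_atTop.comp hw).eventually_ge_atTop 1)) (-l) hu.neg

lemma IsSolutionOn.tendsto_one_of_w_nonneg {β s : ℝ} {f u w : ℝ → ℝ} (hβ : 0 < β) (hs : 0 ≤ s)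
    (h : IsSolutionOn β (Ici 0) f u w) (hf : ∀ x, 0 ≤ x → 0 ≤ f x)
    (hw : ∀ x, s ≤ x → 0 ≤ w x) (hus : 0 < u s) (hu : ∀ x, s ≤ x → u x < 1) :
    Tendsto u atTop (𝓝 1) := by
  obtain ⟨l, hl1, hl, hle⟩ := exists_tendsto_of_deriv_nonneg
    (fun x hx => (h.hasDeriv₂ x (hs.trans hx)).mono (Ici_subset_Ici.2 hs)) hw
    fun x hx => (hu x hx).le
  have hl0 : 0 < l := hus.trans_le (hle s le_rfl)
  rcases hl1.eq_or_lt with rfl | hl1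
  · exact hl
  -- `f'' + f (f' - l)` would have a positive limit slope, while `f (f' - l) ≤ 0`.
  exfalso
  have hlim : Tendsto (fun x => u x * (u x - l) - β * (u x * (u x - 1))) atTop
      (𝓝 (l * (l - l) - β * (l * (l - 1)))) :=
    (hl.mul (hl.sub_const l)).sub ((hl.mul (hl.sub_const 1)).const_mul β)
  have hpos : 0 < β * (l * (1 - l)) := mul_pos hβ (mul_pos hl0 (sub_pos.2 hl1))
  have hG := tendsto_atTop_of_eventually_deriv_ge (half_pos hpos)
    (fun x hx => h.hasDeriv_add_mul_sub l hx)
    ((hlim.eventually_const_lt (by linarith)).mono fun x hx => hx.le)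
  refine h.not_tendsto_w_atTop hl (tendsto_atTop_mono' _ ?_ hG)
  filter_upwards [eventually_ge_atTop s] with x hx
  nlinarith [mul_nonneg (hf x (hs.trans hx)) (sub_nonneg.2 (hle x hx))]

lemma IsSolutionOn.tendsto_one_of_w_nonpos {β s : ℝ} {f u w : ℝ → ℝ} (hβ : 0 < β) (hs : 0 ≤ s)
    (h : IsSolutionOn β (Ici 0) f u w) (hf : ∀ x, 0 ≤ x → 0 ≤ f x)
    (hw : ∀ x, s ≤ x → w x ≤ 0) (hu : ∀ x, s ≤ x → 1 < u x) :
    Tendsto u atTop (𝓝 1) := by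
  obtain ⟨m, hm1, hm, hle⟩ := exists_tendsto_of_deriv_nonneg (M := -1)
    (fun x hx => ((h.hasDeriv₂ x (hs.trans hx)).mono (Ici_subset_Ici.2 hs)).neg)
    (fun x hx => neg_nonneg.2 (hw x hx)) fun x hx => neg_le_neg (hu x hx).le
  obtain ⟨l, rfl⟩ : ∃ l, m = -l := ⟨-m, by ring⟩
  have hl : Tendsto u atTop (𝓝 l) := by simpa using hm.neg
  have hle : ∀ x, s ≤ x → l ≤ u x := fun x hx => neg_le_neg_iff.1 (hle x hx)
  rcases (neg_le_neg_iff.1 hm1).eq_or_lt with rfl | hl1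
  · exact hl
  -- `f'' + f (f' - l)` would have a negative limit slope, while `f (f' - l) ≥ 0`.
  exfalso
  have hlim : Tendsto (fun x => -(u x * (u x - l) - β * (u x * (u x - 1)))) atTop
      (𝓝 (-(l * (l - l) - β * (l * (l - 1))))) :=
    ((hl.mul (hl.sub_const l)).sub ((hl.mul (hl.sub_const 1)).const_mul β)).neg
  have hpos : 0 < β * (l * (l - 1)) := mul_pos hβ (mul_pos (by linarith) (sub_pos.2 hl1))
  have hG := tendsto_atTop_of_eventually_deriv_ge (half_pos hpos)
    (fun x hx => (h.hasDeriv_add_mul_sub l hx).neg)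
    ((hlim.eventually_const_lt (by linarith)).mono fun x hx => hx.le)
  have hneg : Tendsto (fun x => -w x) atTop atTop := by
    refine tendsto_atTop_mono' _ ?_ hG
    filter_upwards [eventually_ge_atTop s] with x hx
    have := mul_nonneg (hf x (hs.trans hx)) (sub_nonneg.2 (hle x hx))
    simp only [Pi.neg_apply]
    linarith
  exact h.not_tendsto_w_atBot hl (tendsto_neg_atTop_iff.1 hneg)

lemma IsSolutionOn.tendsto_zero {β : ℝ} {f u w : ℝ → ℝ} (hβ : 0 < β)
    (h : IsSolutionOn β (Ici 0) f u w) (hf : ∀ x, 0 ≤ x → 0 ≤ f x) (hu0 : u 0 < 1)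
    (hw : ∀ x, 0 ≤ x → w x ≤ 0) (hu : ∀ x, 0 ≤ x → 0 ≤ u x) :
    Tendsto u atTop (𝓝 0) := by
  obtain ⟨m, hm1, hm, hle⟩ := exists_tendsto_of_deriv_nonneg (M := 0)
    (fun x hx => (h.hasDeriv₂ x hx).neg)
    (fun x hx => neg_nonneg.2 (hw x hx)) fun x hx => neg_nonpos.2 (hu x hx)
  obtain ⟨l, rfl⟩ : ∃ l, m = -l := ⟨-m, by ring⟩
  have hl : Tendsto u atTop (𝓝 l) := by simpa using hm.neg
  have hl1 : l < 1 := (neg_le_neg_iff.1 (hle 0 le_rfl)).trans_lt hu0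
  rcases (neg_nonpos.1 hm1).eq_or_lt with rfl | hl0
  · exact hl
  -- `f'''` would be bounded below by a positive constant.
  exfalso
  have hlim : Tendsto (fun x => -(β * (u x * (u x - 1)))) atTop (𝓝 (-(β * (l * (l - 1))))) :=
    ((hl.mul (hl.sub_const 1)).const_mul β).neg
  have hpos : 0 < β * (l * (1 - l)) := mul_pos hβ (mul_pos hl0 (sub_pos.2 hl1))
  refine h.not_tendsto_w_atTop hl
    (tendsto_atTop_of_eventually_deriv_ge (half_pos hpos) h.hasDeriv₃ ?_)
  filter_upwards [eventually_ge_atTop 0, hlim.eventually_const_lt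
    (show β * (l * (1 - l)) / 2 < _ by linarith)] with x hx hx'
  have := mul_nonneg (hf x hx) (neg_nonneg.2 (hw x hx))
  linarith

/-! ### Comparison of two solutions with `f'` as the independent variable -/

/-- A function with positive continuous derivative on `[0, t]` has a differentiable inverse. -/
lemma exists_inverse_of_deriv_pos {g g' : ℝ → ℝ} {t : ℝ} (ht : 0 ≤ t)
    (hg : ∀ x ∈ Icc 0 t, HasDerivWithinAt g (g' x) (Icc 0 t) x)
    (hg'c : ContinuousOn g' (Icc 0 t)) (hg' : ∀ x ∈ Icc 0 t, 0 < g' x) :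
    ∃ T : ℝ → ℝ, T (g 0) = 0 ∧ T (g t) = t ∧ MapsTo T (Icc (g 0) (g t)) (Icc 0 t) ∧
      (∀ s ∈ Icc (g 0) (g t), g (T s) = s) ∧
      ∀ s ∈ Icc (g 0) (g t), HasDerivWithinAt T (g' (T s))⁻¹ (Icc (g 0) (g t)) s := by
  have hgc : ContinuousOn g (Icc 0 t) := fun x hx => (hg x hx).continuousWithinAt
  obtain ⟨x₀, hx₀, hmin⟩ := isCompact_Icc.exists_isMinOn ⟨0, le_rfl, ht⟩ hg'c
  set m := g' x₀ with hm
  have hm0 : 0 < m := hg' x₀ hx₀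
  have hlow : ∀ x ∈ Icc 0 t, ∀ y ∈ Icc 0 t, x ≤ y → m * (y - x) ≤ g y - g x := by
    intro x hx y hy hxy
    have hsub : Icc x y ⊆ Icc 0 t := Icc_subset_Icc hx.1 hy.2
    have := le_of_hasDerivWithinAt_nonneg (g := fun z => g z - m * z) (g' := fun z => g' z - m * 1)
      hxy (fun z hz => ((hg z (hsub hz)).mono hsub).sub ((hasDerivWithinAt_id z _).const_mul m))
      fun z hz => by
        have : m ≤ g' z := hmin (hsub (Ioo_subset_Icc_self hz))
        linarith
    linarith
  have hdist : ∀ x ∈ Icc 0 t, ∀ y ∈ Icc 0 t, m * |y - x| ≤ |g y - g x| := by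
    intro x hx y hy
    rcases le_total x y with h | h
    · rw [abs_of_nonneg (sub_nonneg.2 h)]
      exact (hlow x hx y hy h).trans (le_abs_self _)
    · rw [abs_sub_comm y x, abs_of_nonneg (sub_nonneg.2 h), abs_sub_comm]
      exact (hlow y hy x hx h).trans (le_abs_self _)
  have hinj : ∀ x ∈ Icc 0 t, ∀ y ∈ Icc 0 t, g x = g y → x = y := by
    intro x hx y hy hxy
    have := hdist x hx y hy
    rw [hxy, sub_self, abs_zero] at this
    have h0 : |y - x| ≤ 0 := by
      by_contra! hpos
      linarith [mul_pos hm0 hpos]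
    linarith [abs_nonpos_iff.1 h0]
  have hsurj : ∀ s, ∃ x, s ∈ Icc (g 0) (g t) → x ∈ Icc 0 t ∧ g x = s := by
    intro s
    by_cases hs : s ∈ Icc (g 0) (g t)
    · obtain ⟨x, hx, hxs⟩ := intermediate_value_Icc ht hgc hs
      exact ⟨x, fun _ => ⟨hx, hxs⟩⟩
    · exact ⟨0, fun h => absurd h hs⟩
  choose T hT using hsurj
  have hle : g 0 ≤ g t := by
    have := hlow 0 ⟨le_rfl, ht⟩ t ⟨ht, le_rfl⟩ ht
    nlinarith
  have hmaps : MapsTo T (Icc (g 0) (g t)) (Icc 0 t) := fun s hs => (hT s hs).1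
  refine ⟨T, ?_, ?_, hmaps, fun s hs => (hT s hs).2, fun s hs => ?_⟩
  · have := hT _ ⟨le_rfl, hle⟩
    exact hinj _ this.1 _ ⟨le_rfl, ht⟩ this.2
  · have := hT _ ⟨hle, le_rfl⟩
    exact hinj _ this.1 _ ⟨ht, le_rfl⟩ this.2
  have hcont : ContinuousWithinAt T (Icc (g 0) (g t)) s := by
    rw [Metric.continuousWithinAt_iff]
    intro ε hε
    refine ⟨m * ε, mul_pos hm0 hε, fun r hr hrs => ?_⟩
    have := hdist _ (hmaps hs) _ (hmaps hr)
    rw [(hT r hr).2, (hT s hs).2] at this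
    rw [Real.dist_eq] at hrs ⊢
    exact lt_of_mul_lt_mul_left (this.trans_lt hrs) hm0.le
  have hd := hg' _ (hmaps hs)
  have hF : HasFDerivWithinAt g
      (ContinuousLinearEquiv.unitsEquivAut ℝ (Units.mk0 (g' (T s)) hd.ne') : ℝ →L[ℝ] ℝ)
      (Icc 0 t) (T s) := by
    refine (hg _ (hmaps hs)).hasFDerivWithinAt.congr_fderiv ?_
    ext
    simp
  have hT' := HasFDerivWithinAt.of_local_left_inverse
    (tendsto_nhdsWithin_iff.2 ⟨hcont, eventually_mem_nhdsWithin.mono fun r hr => hmaps hr⟩)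
    hF hs (eventually_mem_nhdsWithin.mono fun r hr => (hT r hr).2)
  refine hT'.hasDerivWithinAt.congr_deriv ?_
  simp [ContinuousLinearEquiv.unitsEquivAut]

/-- The equation with `s = ε (f' - b) ∈ [0, S]` as the independent variable, where `ε = 1` on
convex and `ε = -1` on concave arcs: `φ` is `f` and `P` is `|f''|` as a function of `s`. -/
structure IsCroccoSolution (β b ε S : ℝ) (φ P : ℝ → ℝ) : Prop where
  pos : ∀ s ∈ Icc 0 S, 0 < P s
  deriv_φ : ∀ s ∈ Icc 0 S, HasDerivWithinAt φ ((b + ε * s) / P s) (Icc 0 S) s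
  deriv_P : ∀ s ∈ Icc 0 S, HasDerivWithinAt P
    (-φ s - ε * β * ((b + ε * s) * (b + ε * s - 1)) / P s) (Icc 0 S) s

lemma IsIVPSolutionOn.exists_crocco {β a b c ε t : ℝ} {f u w : ℝ → ℝ} (hε : ε * ε = 1)
    (ht : 0 ≤ t) (h : IsIVPSolutionOn β a b c (Icc 0 t) f u w)
    (hw : ∀ x ∈ Icc 0 t, 0 < ε * w x) :
    ∃ φ P, IsCroccoSolution β b ε (ε * (u t - b)) φ P ∧ φ 0 = a ∧ P 0 = ε * c ∧
      P (ε * (u t - b)) = ε * w t := by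
  obtain ⟨T, hT0, hTt, hmaps, hinv, hd⟩ := exists_inverse_of_deriv_pos ht
    (g := fun x => ε * (u x - b)) (g' := fun x => ε * w x)
    (fun x hx => ((h.sol.hasDeriv₂ x hx).sub_const b).const_mul ε)
    (h.sol.continuousOn_w.const_mul ε) hw
  have h00 : ε * (u 0 - b) = 0 := by rw [h.init₁]; ring
  simp only [h00] at hT0 hmaps hinv hd
  refine ⟨f ∘ T, fun s => ε * w (T s), ⟨fun s hs => hw _ (hmaps hs), fun s hs => ?_,
    fun s hs => ?_⟩, ?_, ?_, ?_⟩
  · have hu : u (T s) = b + ε * s := by linear_combination ε * hinv s hs - (u (T s) - b) * hε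
    have := (h.sol.hasDeriv₁ _ (hmaps hs)).comp s (hd s hs) hmaps
    exact this.congr_deriv (by rw [hu, div_eq_mul_inv])
  · have hu : u (T s) = b + ε * s := by linear_combination ε * hinv s hs - (u (T s) - b) * hε
    have := ((h.sol.hasDeriv₃ _ (hmaps hs)).comp s (hd s hs) hmaps).const_mul ε
    refine this.congr_deriv ?_
    have hε0 : ε ≠ 0 := left_ne_zero_of_mul (hw _ (hmaps hs)).ne'
    have hw0 : w (T s) ≠ 0 := right_ne_zero_of_mul (hw _ (hmaps hs)).ne'
    simp only [Function.comp, hu]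
    field_simp
  · simp [hT0, h.init₀]
  · simp [hT0, h.init₂]
  · simp only [hTt]

/-- A solution starting with larger `|f''|` keeps a larger `|f''|` at equal values of `f'`: as long
as it does, it takes less time to reach a given value of `f'`, so its `f` is smaller there. -/
lemma IsCroccoSolution.lt {β b ε S : ℝ} {φ₁ P₁ φ₂ P₂ : ℝ → ℝ}
    (h₁ : IsCroccoSolution β b ε S φ₁ P₁) (h₂ : IsCroccoSolution β b ε S φ₂ P₂)
    (hφ : φ₁ 0 = φ₂ 0) (hP : P₁ 0 < P₂ 0) (hu : ∀ s ∈ Icc 0 S, 0 < b + ε * s) :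
    ∀ s ∈ Icc 0 S, P₁ s < P₂ s ∧ φ₂ s ≤ φ₁ s := by
  have hφlt : ∀ x ∈ Icc 0 S, 0 < x → (∀ y ∈ Ioo 0 x, 0 < P₂ y - P₁ y) → φ₂ x < φ₁ x := by
    intro x hx hx0 hpos
    have hsub : Icc 0 x ⊆ Icc 0 S := Icc_subset_Icc_right hx.2
    have := lt_of_hasDerivWithinAt_pos (g := fun y => φ₁ y - φ₂ y) hx0
      (fun y hy => ((h₁.deriv_φ y (hsub hy)).sub (h₂.deriv_φ y (hsub hy))).mono hsub)
      fun y hy => by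
        have hy' := hsub (Ioo_subset_Icc_self hy)
        exact sub_pos.2 (div_lt_div_of_pos_left (hu y hy') (h₁.pos y hy')
          (by linarith [hpos y hy]))
    linarith
  have hgt := pos_of_deriv_pos_of_eq_zero (g := fun s => P₂ s - P₁ s)
    (fun s hs => (h₂.deriv_P s hs).sub (h₁.deriv_P s hs)) (sub_nonneg.2 hP.le)
    (fun x hx hpos hx0 => by
      rcases hx.1.eq_or_lt with h0 | h0
      · rw [← h0] at hx0
        linarith
      have := hφlt x hx h0 hpos
      rw [sub_eq_zero.1 hx0]
      linarith)
  intro s hs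
  rcases hs.1.eq_or_lt with h0 | h0
  · rw [← h0]
    exact ⟨hP, hφ.ge⟩
  · exact ⟨sub_pos.1 (hgt s ⟨h0, hs.2⟩),
      (hφlt s hs h0 fun y hy => hgt y ⟨hy.1, hy.2.le.trans hs.2⟩).le⟩

/-- On concave arcs the gap between the two values of `|f''|` does not decrease. -/
lemma IsCroccoSolution.gap_le {β b S : ℝ} {φ₁ P₁ φ₂ P₂ : ℝ → ℝ} (hβ : 0 ≤ β) (hb : b ≤ 1)
    (h₁ : IsCroccoSolution β b (-1) S φ₁ P₁) (h₂ : IsCroccoSolution β b (-1) S φ₂ P₂)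
    (hφ : φ₁ 0 = φ₂ 0) (hP : P₁ 0 < P₂ 0) (hu : ∀ s ∈ Icc 0 S, 0 < b + -1 * s) (hS : 0 ≤ S) :
    P₂ 0 - P₁ 0 ≤ P₂ S - P₁ S := by
  have hlt := h₁.lt h₂ hφ hP hu
  refine le_of_hasDerivWithinAt_nonneg (g := fun s => P₂ s - P₁ s) hS
    (fun s hs => (h₂.deriv_P s hs).sub (h₁.deriv_P s hs)) fun s hs => ?_
  have hs' := Ioo_subset_Icc_self hs
  have h1 := h₁.pos s hs'
  have h2 := hlt s hs'
  have h3 : 0 ≤ β * ((b + -1 * s) * (1 - (b + -1 * s))) :=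
    mul_nonneg hβ (mul_nonneg (hu s hs').le (by linarith [hs.1]))
  have h4 := div_le_div_of_nonneg_left h3 h1 h2.1.le
  have e : ∀ q, -1 * β * ((b + -1 * s) * (b + -1 * s - 1)) / q
      = β * ((b + -1 * s) * (1 - (b + -1 * s))) / q := fun q => by ring
  rw [e, e]
  linarith

lemma w_lt_w_of_convex {β a b c₁ c₂ t₁ t₂ : ℝ} {f₁ u₁ w₁ f₂ u₂ w₂ : ℝ → ℝ} (hb : 0 < b)
    (hc : c₁ < c₂) (ht₁ : 0 ≤ t₁) (ht₂ : 0 ≤ t₂)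
    (h₁ : IsIVPSolutionOn β a b c₁ (Icc 0 t₁) f₁ u₁ w₁)
    (h₂ : IsIVPSolutionOn β a b c₂ (Icc 0 t₂) f₂ u₂ w₂)
    (hw₁ : ∀ x ∈ Icc 0 t₁, 0 < w₁ x) (hw₂ : ∀ x ∈ Icc 0 t₂, 0 < w₂ x) (hu : u₁ t₁ = u₂ t₂) :
    w₁ t₁ < w₂ t₂ := by
  obtain ⟨φ₁, P₁, hC₁, hφ₁, hP₁, hS₁⟩ := h₁.exists_crocco (ε := 1) (by ring) ht₁
    (by simpa using hw₁)
  obtain ⟨φ₂, P₂, hC₂, hφ₂, hP₂, hS₂⟩ := h₂.exists_crocco (ε := 1) (by ring) ht₂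
    (by simpa using hw₂)
  rw [hu] at hC₁ hS₁
  have hS : 0 ≤ 1 * (u₂ t₂ - b) := by
    have := le_of_hasDerivWithinAt_nonneg ht₂ h₂.sol.hasDeriv₂
      fun x hx => (hw₂ x (Ioo_subset_Icc_self hx)).le
    rw [h₂.init₁] at this
    linarith
  have := (hC₁.lt hC₂ (by rw [hφ₁, hφ₂]) (by rw [hP₁, hP₂]; linarith)
    (fun s hs => by linarith [hs.1]) _ ⟨hS, le_rfl⟩).1
  rw [hS₁, hS₂] at this
  linarith

lemma w_le_w_add_of_concave {β a b c₁ c₂ t₁ t₂ : ℝ} {f₁ u₁ w₁ f₂ u₂ w₂ : ℝ → ℝ} (hβ : 0 ≤ β)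
    (hb : b ≤ 1) (hc : c₂ < c₁) (ht₁ : 0 ≤ t₁) (ht₂ : 0 ≤ t₂)
    (h₁ : IsIVPSolutionOn β a b c₁ (Icc 0 t₁) f₁ u₁ w₁)
    (h₂ : IsIVPSolutionOn β a b c₂ (Icc 0 t₂) f₂ u₂ w₂)
    (hw₁ : ∀ x ∈ Icc 0 t₁, w₁ x < 0) (hw₂ : ∀ x ∈ Icc 0 t₂, w₂ x < 0) (hu : u₁ t₁ = u₂ t₂)
    (hu0 : 0 < u₂ t₂) : w₂ t₂ ≤ w₁ t₁ + (c₂ - c₁) := by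
  obtain ⟨φ₁, P₁, hC₁, hφ₁, hP₁, hS₁⟩ := h₁.exists_crocco (ε := -1) (by ring) ht₁
    (by simpa using hw₁)
  obtain ⟨φ₂, P₂, hC₂, hφ₂, hP₂, hS₂⟩ := h₂.exists_crocco (ε := -1) (by ring) ht₂
    (by simpa using hw₂)
  rw [hu] at hC₁ hS₁
  have hS : 0 ≤ -1 * (u₂ t₂ - b) := by
    have := le_of_hasDerivWithinAt_nonneg ht₂ (fun x hx => (h₂.sol.hasDeriv₂ x hx).neg)
      fun x hx => (neg_pos.2 (hw₂ x (Ioo_subset_Icc_self hx))).le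
    simp only [Pi.neg_apply, h₂.init₁] at this
    linarith
  have := hC₁.gap_le hβ hb hC₂ (by rw [hφ₁, hφ₂]) (by rw [hP₁, hP₂]; linarith)
    (fun s hs => by linarith [hs.2]) hS
  rw [hP₁, hP₂, hS₁, hS₂] at this
  linarith

/-! ### Convexity from the sign of `f''` -/

lemma IsSolutionOn.deriv2_eq {β : ℝ} {f u w : ℝ → ℝ} (h : IsSolutionOn β (Ici 0) f u w) {x : ℝ}
    (hx : 0 < x) : deriv f x = u x ∧ deriv^[2] f x = w x := by
  have h1 : ∀ y, 0 < y → deriv f y = u y := fun y hy =>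
    ((h.hasDeriv₁ y hy.le).hasDerivAt (Ici_mem_nhds hy)).deriv
  refine ⟨h1 x hx, ?_⟩
  have h2 : deriv f =ᶠ[𝓝 x] u := by
    filter_upwards [Ioi_mem_nhds hx] with y hy using h1 y hy
  simp only [Function.iterate_succ, Function.iterate_zero, Function.comp, id]
  rw [h2.deriv_eq]
  exact ((h.hasDeriv₂ x hx.le).hasDerivAt (Ici_mem_nhds hx)).deriv

lemma pos_of_mem_interior {D : Set ℝ} (hD : D ⊆ Ici 0) {x : ℝ} (hx : x ∈ interior D) : 0 < x := by
  simpa using interior_mono hD hx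

lemma IsSolutionOn.strictConvexOn {β : ℝ} {f u w : ℝ → ℝ} (h : IsSolutionOn β (Ici 0) f u w)
    {D : Set ℝ} (hD : Convex ℝ D) (hD0 : D ⊆ Ici 0) (hw : ∀ x ∈ interior D, 0 < w x) :
    StrictConvexOn ℝ D f :=
  strictConvexOn_of_deriv2_pos hD
    (fun x hx => ((h.hasDeriv₁ x (hD0 hx)).mono hD0).continuousWithinAt)
    fun x hx => by
      rw [(h.deriv2_eq (pos_of_mem_interior hD0 hx)).2]
      exact hw x hx

lemma IsSolutionOn.strictConcaveOn {β : ℝ} {f u w : ℝ → ℝ} (h : IsSolutionOn β (Ici 0) f u w)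
    {D : Set ℝ} (hD : Convex ℝ D) (hD0 : D ⊆ Ici 0) (hw : ∀ x ∈ interior D, w x < 0) :
    StrictConcaveOn ℝ D f :=
  strictConcaveOn_of_deriv2_neg hD
    (fun x hx => ((h.hasDeriv₁ x (hD0 hx)).mono hD0).continuousWithinAt)
    fun x hx => by
      rw [(h.deriv2_eq (pos_of_mem_interior hD0 hx)).2]
      exact hw x hx

/-! ### Solutions with `f''(0) < 0` -/

lemma exists_concave_of_not_reaches {β a b c : ℝ} (hβ : β ∈ Ioc (0 : ℝ) 1) (ha : 0 ≤ a)
    (hb : b ∈ Ioo (0 : ℝ) 1) (hc : c < 0) (hA : ¬ ReachesNegativeU β a b c)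
    (hB : ¬ ReachesPositiveW β a b c) :
    ∃ u w, IsIVPSolutionOn β a b c (Ici 0) (maxSol β a b c) u w ∧ (∀ x, 0 ≤ x → w x < 0) ∧
      Tendsto u atTop (𝓝 0) := by
  obtain ⟨u, w, hs, hpos⟩ := exists_global_of_not_reachesNegativeU hβ.1 ha hA
  have hw : ∀ x, 0 ≤ x → w x < 0 := by
    intro x hx
    have hs' := hs.mono (Icc_subset_Ici_self : Icc 0 (x + 1) ⊆ Ici 0)
    rcases hs'.w_neg_or hβ ha hb hc with h | ⟨-, τ, hτ, -, h1, h2⟩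
    · exact h x ⟨hx, by linarith⟩
    · rcases hτ.2.eq_or_lt with h | h
      · exact h1 x ⟨hx, by linarith⟩
      · exact absurd ⟨x + 1, by linarith, _, u, w, hs', h2 _ ⟨h, le_rfl⟩⟩ hB
  exact ⟨u, w, hs, hw, hs.sol.tendsto_zero hβ.1 (fun x hx => (hpos x hx).1)
    (by rw [hs.init₁]; exact hb.2) (fun x hx => (hw x hx).le) fun x hx => (hpos x hx).2⟩

lemma ReachesPositiveW.concaveConvex {β a b c : ℝ} (hβ : β ∈ Ioc (0 : ℝ) 1) (ha : 0 ≤ a)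
    (hb : b ∈ Ioo (0 : ℝ) 1) (hc : c < 0) (hB : ReachesPositiveW β a b c) :
    SolvesBVP β a b 1 (maxSol β a b c) ∧ IsConcaveConvex (maxSol β a b c) := by
  have hA : ¬ ReachesNegativeU β a b c := fun h => h.not_reachesPositiveW hβ ha hb hc hB
  obtain ⟨u, w, hs, hpos⟩ := exists_global_of_not_reachesNegativeU hβ.1 ha hA
  obtain ⟨t, ht, f', u', w', hs', hwt⟩ := hB
  rw [← ((hs.mono (Icc_subset_Ici_self : Icc 0 t ⊆ Ici 0)).eq hs' ht le_rfl le_rfl).2.2] at hwt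
  have key : ∀ T, t ≤ T → (∀ x ∈ Icc 0 T, 0 < u x ∧ u x < 1) ∧ ∃ τ ∈ Ioc 0 T, w τ = 0 ∧
      (∀ x ∈ Ico 0 τ, w x < 0) ∧ ∀ x ∈ Ioc τ T, 0 < w x := fun T hT => by
    rcases (hs.mono (Icc_subset_Ici_self : Icc 0 T ⊆ Ici 0)).w_neg_or hβ ha hb hc with h | h
    · exact absurd (h t ⟨ht, hT⟩) (not_lt.2 hwt.le)
    · exact h
  obtain ⟨-, τ, hτ, hτ0, hneg, -⟩ := key t le_rfl
  have hafter : ∀ x, τ < x → 0 < w x := by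
    intro x hx
    obtain ⟨-, τ', hτ', hτ'0, hneg', hpos'⟩ := key (max t x) (le_max_left _ _)
    have heq : τ = τ' := by
      rcases lt_trichotomy τ τ' with h | h | h
      · exact absurd hτ0 (hneg' τ ⟨hτ.1.le, h⟩).ne
      · exact h
      · exact absurd hτ0 (hpos' τ ⟨h, hτ.2.trans (le_max_left _ _)⟩).ne'
    exact hpos' x ⟨heq ▸ hx, le_max_right _ _⟩
  have hu : ∀ x, 0 ≤ x → 0 < u x ∧ u x < 1 := fun x hx =>
    (key (max t x) (le_max_left _ _)).1 x ⟨hx, le_max_right _ _⟩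
  refine ⟨⟨u, w, hs.sol, hs.init₀, hs.init₁, hs.sol.tendsto_one_of_w_nonneg hβ.1 hτ.1.le
    (fun x hx => (hpos x hx).1) (fun x hx => ?_) (hu τ hτ.1.le).1
    fun x hx => (hu x (hτ.1.le.trans hx)).2⟩, τ, hτ.1, ?_, ?_⟩
  · rcases hx.eq_or_lt with h | h
    · rw [← h, hτ0]
    · exact (hafter x h).le
  · refine hs.sol.strictConcaveOn (convex_Icc _ _) Icc_subset_Ici_self fun x hx => ?_
    rw [interior_Icc] at hx
    exact hneg x ⟨hx.1.le, hx.2⟩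
  · refine hs.sol.strictConvexOn (convex_Ici _) (Ici_subset_Ici.2 hτ.1.le) fun x hx => ?_
    rw [interior_Ici] at hx
    exact hafter x hx

/-- If `f''` does not become positive for `f''(0) = c₁ < 0`, then for `f''(0) = c₂ < c₁` one has
`f'' ≤ c₂ - c₁` as long as `f' > 0`, by comparison with the first solution at equal values of `f'`;
so `f'` becomes negative. -/
lemma reachesNegativeU_of_lt {β a b c₁ c₂ : ℝ} (hβ : β ∈ Ioc (0 : ℝ) 1) (ha : 0 ≤ a)
    (hb : b ∈ Ioo (0 : ℝ) 1) (hc : c₂ < c₁) (hc₁ : c₁ < 0) (hB : ¬ ReachesPositiveW β a b c₁) :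
    ReachesNegativeU β a b c₂ := by
  have hreach : ∀ v, 0 < v → v ≤ b → ∃ t, 0 ≤ t ∧ ∃ f u w,
      IsIVPSolutionOn β a b c₁ (Icc 0 t) f u w ∧ (∀ x ∈ Icc 0 t, w x < 0) ∧ u t = v := by
    intro v hv hvb
    obtain ⟨r, hr, f, u, w, hs, hw, hu⟩ : ∃ r, 0 ≤ r ∧ ∃ f u w,
        IsIVPSolutionOn β a b c₁ (Icc 0 r) f u w ∧ (∀ x ∈ Icc 0 r, w x < 0) ∧ u r < v := by
      by_cases hA : ReachesNegativeU β a b c₁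
      · obtain ⟨r, hr, f, u, w, hs, hu⟩ := id hA
        exact ⟨r, hr, f, u, w, hs, hA.w_neg hβ ha hb hc₁ hs, hu.trans hv⟩
      · obtain ⟨u, w, hs, hw, hlim⟩ := exists_concave_of_not_reaches hβ ha hb hc₁ hA hB
        obtain ⟨r, hr, hru⟩ := ((hlim.eventually_lt_const hv).and (eventually_ge_atTop 0)).exists
        exact ⟨r, hru, _, u, w, hs.mono Icc_subset_Ici_self, fun x hx => hw x hx.1, hr⟩
    obtain ⟨t, ht, htv⟩ := intermediate_value_Icc' hr hs.sol.continuousOn_u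
      ⟨hu.le, by rwa [hs.init₁]⟩
    exact ⟨t, ht.1, f, u, w, hs.mono (Icc_subset_Icc_right ht.2),
      fun x hx => hw x ⟨hx.1, hx.2.trans ht.2⟩, htv⟩
  by_contra hA
  obtain ⟨u, w, hs, hpos⟩ := exists_global_of_not_reachesNegativeU hβ.1 ha hA
  have hs' : ∀ t, IsIVPSolutionOn β a b c₂ (Icc 0 t) (maxSol β a b c₂) u w := fun t =>
    hs.mono Icc_subset_Ici_self
  have hu : ∀ t, 0 ≤ t → 0 < u t := by
    intro t ht
    rcases (hs' (t + 1)).w_neg_or hβ ha hb (hc.trans hc₁) with h | h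
    · have h1 := ((hs' (t + 1)).sol.mono (Icc_subset_Icc_left ht)).u_lt_of_w_neg
        (lt_add_one t) fun y hy => h y ⟨ht.trans hy.1.le, hy.2.le⟩
      linarith [(hpos (t + 1) (by linarith)).2]
    · exact (h.1 t ⟨ht, by linarith⟩).1
  have hgap : ∀ t, 0 ≤ t → (∀ x ∈ Icc 0 t, w x < 0) → w t ≤ c₂ - c₁ := by
    intro t ht hw
    have hub : u t ≤ b := by
      rcases ht.eq_or_lt with h | h
      · rw [← h, hs.init₁]
      · have := (hs' t).sol.u_lt_of_w_neg h fun y hy => hw y (Ioo_subset_Icc_self hy)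
        rw [hs.init₁] at this
        exact this.le
    obtain ⟨t₁, ht₁, f₁, u₁, w₁, hs₁, hw₁, hu₁⟩ := hreach (u t) (hu t ht) hub
    have := w_le_w_add_of_concave hβ.1.le hb.2.le hc ht₁ ht hs₁ (hs' t) hw₁ hw hu₁ (hu t ht)
    linarith [hw₁ t₁ ⟨ht₁, le_rfl⟩]
  have hlt : ∀ t, 0 ≤ t → w t < (c₂ - c₁) / 2 := by
    intro t ht
    by_contra! hge
    obtain ⟨τ, hτ, hτk, hτlt⟩ := exists_first_hit ht (hs' t).sol.continuousOn_w
      (by rw [hs.init₂]; linarith) hge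
    have := hgap τ hτ.1.le fun x hx => by
      rcases hx.2.eq_or_lt with h | h
      · rw [h, hτk]; linarith
      · linarith [hτlt x ⟨hx.1, h⟩]
    linarith
  have hlim := tendsto_atTop_of_deriv_ge (s := 0) (k := (c₁ - c₂) / 2) (by linarith)
    (fun x hx => (hs.sol.hasDeriv₂ x hx).neg) fun x hx => by linarith [hlt x hx]
  obtain ⟨x, hx, hx0⟩ := ((hlim.eventually_gt_atTop 0).and (eventually_ge_atTop 0)).exists
  simp only [Pi.neg_apply] at hx
  linarith [hu x hx0]

lemma exists_reachesNegativeU {β a b : ℝ} (hβ : β ∈ Ioc (0 : ℝ) 1) (ha : 0 ≤ a)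
    (hb : b ∈ Ioo (0 : ℝ) 1) : ∃ c < 0, ReachesNegativeU β a b c := by
  -- For this `c`, `f''` stays below `-2` on `[0, 1]` as long as `0 ≤ f' ≤ 1`.
  refine ⟨-(2 * a + 3), by linarith, ?_⟩
  by_contra hA
  obtain ⟨u, w, hs, hpos⟩ := exists_global_of_not_reachesNegativeU hβ.1 ha hA
  have hu1 : ∀ t, 0 ≤ t → u t < 1 := fun t ht =>
    (hs.mono (Icc_subset_Ici_self : Icc 0 t ⊆ Ici 0)).u_lt_one hβ.2 hb.2
      (by nlinarith [mul_nonneg ha (sub_nonneg.2 hb.2.le)]) (fun x hx => (hpos x hx.1).2)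
      t ⟨ht, le_rfl⟩
  have hab : a * b ≤ a := mul_le_of_le_one_right ha hb.2.le
  -- `f'' + f f'` has derivative at most `1`.
  have hw : ∀ t ∈ Icc (0 : ℝ) 1, w t ≤ -2 := by
    intro t ht
    have := le_of_hasDerivWithinAt_nonneg
      (g := fun x => 1 * x - (w x + maxSol β a b (-(2 * a + 3)) x * (u x - 0)))
      (g' := fun x => 1 * 1 - (u x * (u x - 0) - β * (u x * (u x - 1)))) ht.1
      (fun x hx => (((hasDerivWithinAt_id x _).const_mul 1).sub
        ((hs.sol.hasDeriv_add_mul_sub 0 hx.1).mono Icc_subset_Ici_self)))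
      fun x hx => by
        have h0 := (hpos x hx.1.le).2
        have h1 := hu1 x hx.1.le
        nlinarith [mul_nonneg (sub_nonneg.2 hβ.2) (mul_nonneg h0 (sub_nonneg.2 h1.le))]
    simp only [hs.init₀, hs.init₁, hs.init₂] at this
    nlinarith [mul_nonneg (hpos t ht.1).1 (hpos t ht.1).2, ht.2]
  have := le_of_hasDerivWithinAt_nonneg (g := fun x => -2 * x - u x) (g' := fun x => -2 * 1 - w x)
    zero_le_one (fun x hx => ((hasDerivWithinAt_id x _).const_mul (-2)).sub
      ((hs.sol.hasDeriv₂ x hx.1).mono Icc_subset_Ici_self))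
    fun x hx => by linarith [hw x (Ioo_subset_Icc_self hx)]
  simp only [hs.init₁] at this
  linarith [(hpos 1 zero_le_one).2, hb.2]

/-! ### Solutions with `f''(0) ≥ 0` -/

/-- At the first time at which `f' = 1` one has `f'' > 0`, and then `f' > 1` ever after. -/
lemma IsIVPSolutionOn.exists_hit_one {β a b c t y : ℝ} {f u w : ℝ → ℝ} (hβ : β ≤ 1) (hb : b < 1)
    (h : IsIVPSolutionOn β a b c (Icc 0 t) f u w) (hy : y ∈ Icc 0 t) (hu : 1 ≤ u y) :
    ∃ σ ∈ Ioc 0 y, u σ = 1 ∧ 0 < w σ ∧ (∀ x ∈ Ico 0 σ, u x < 1) ∧ ∀ x ∈ Ioc σ t, 1 < u x := by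
  obtain ⟨σ, hσ, hσ1, hlt⟩ := exists_first_hit hy.1
    (h.sol.continuousOn_u.mono (Icc_subset_Icc_right hy.2)) (by rwa [h.init₁]) hu
  have hσt : σ ≤ t := hσ.2.trans hy.2
  have h' := h.mono (Icc_subset_Icc_right hσt)
  have h1 := deriv_nonneg_of_first_hit hσ.1 le_rfl (h'.sol.hasDeriv₂ σ ⟨hσ.1.le, le_rfl⟩) hσ1
    fun y hy => (hlt y ⟨hy.1.le, hy.2⟩).le
  have hw : 0 < w σ := h1.lt_of_ne' (h'.w_ne_zero (Or.inr rfl) hb.ne hσ.1.le hσ1)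
  exact ⟨σ, hσ, hσ1, hw, hlt, (h.sol.mono (Icc_subset_Icc_left hσ.1.le)).one_lt_u hβ hσ1 hw⟩

lemma not_reachesNegativeU_of_nonneg {β a b c : ℝ} (hβ : β ∈ Ioc (0 : ℝ) 1)
    (hb : b ∈ Ioo (0 : ℝ) 1) (hc : 0 ≤ c) : ¬ ReachesNegativeU β a b c := by
  rintro ⟨r, hr, f, u, w, hs, hu⟩
  have hr0 : 0 < r := hr.lt_of_ne fun h => by
    rw [← h, hs.init₁] at hu
    linarith [hb.1]
  by_cases h1 : ∀ x ∈ Icc 0 r, u x < 1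
  · have := (hs.sol.w_pos_of_u_lt_one hβ.1 (by rwa [hs.init₂]) (by rw [hs.init₁]; exact hb.1) h1
      r ⟨hr0, le_rfl⟩).2
    rw [hs.init₁] at this
    linarith [hb.1]
  · push Not at h1
    obtain ⟨y, hy, hy1⟩ := h1
    obtain ⟨σ, hσ, hσ1, -, -, hgt⟩ := hs.exists_hit_one hβ.2 hb.2 hy hy1
    rcases (hσ.2.trans hy.2).eq_or_lt with h | h
    · rw [← h] at hu
      linarith
    · linarith [hgt r ⟨h, le_rfl⟩]

lemma exists_global_of_nonneg {β a b c : ℝ} (hβ : β ∈ Ioc (0 : ℝ) 1) (ha : 0 ≤ a)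
    (hb : b ∈ Ioo (0 : ℝ) 1) (hc : 0 ≤ c) :
    ∃ u w, IsIVPSolutionOn β a b c (Ici 0) (maxSol β a b c) u w ∧
      ∀ t, 0 ≤ t → 0 ≤ maxSol β a b c t ∧ 0 ≤ u t :=
  exists_global_of_not_reachesNegativeU hβ.1 ha (not_reachesNegativeU_of_nonneg hβ hb hc)

lemma reachesPositiveW_zero {β a b : ℝ} (hβ : β ∈ Ioc (0 : ℝ) 1) (ha : 0 ≤ a)
    (hb : b ∈ Ioo (0 : ℝ) 1) : ReachesPositiveW β a b 0 := by
  obtain ⟨u, w, hs, -⟩ := exists_global_of_nonneg hβ ha hb le_rfl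
  have h := hs.mono (show Icc (0 : ℝ) 1 ⊆ Ici 0 from Icc_subset_Ici_self)
  have hpos := eventually_pos_right one_pos (h.sol.hasDeriv₃ 0 ⟨le_rfl, zero_le_one⟩) hs.init₂ (by
    rw [hs.init₁, hs.init₂]
    nlinarith [mul_pos hβ.1 (mul_pos hb.1 (sub_pos.2 hb.2))])
  obtain ⟨t, ht, ht0⟩ := (hpos.and self_mem_nhdsWithin).exists
  have ht0 : (0 : ℝ) < t := ht0
  exact ⟨t, ht0.le, _, u, w, hs.mono (Icc_subset_Ici_self : Icc 0 t ⊆ Ici 0), ht⟩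

/-- If `f'` never exceeds `1` then `f` is convex. -/
lemma exists_convex_of_not_exceedsOne {β a b c : ℝ} (hβ : β ∈ Ioc (0 : ℝ) 1) (ha : 0 ≤ a)
    (hb : b ∈ Ioo (0 : ℝ) 1) (hc : 0 ≤ c) (hD : ¬ ExceedsOne β a b c) :
    ∃ u w, IsIVPSolutionOn β a b c (Ici 0) (maxSol β a b c) u w ∧
      (∀ t, 0 ≤ t → 0 ≤ maxSol β a b c t) ∧ (∀ t, 0 ≤ t → b ≤ u t ∧ u t < 1) ∧
      ∀ t, 0 < t → 0 < w t := by
  obtain ⟨u, w, hs, hpos⟩ := exists_global_of_nonneg hβ ha hb hc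
  have hs' : ∀ t, IsIVPSolutionOn β a b c (Icc 0 t) (maxSol β a b c) u w := fun t =>
    hs.mono Icc_subset_Ici_self
  have hu : ∀ t, 0 ≤ t → u t < 1 := by
    intro t ht
    by_contra! h1
    obtain ⟨σ, hσ, -, -, -, hgt⟩ := (hs' (t + 1)).exists_hit_one hβ.2 hb.2 ⟨ht, by linarith⟩ h1
    exact hD ⟨t + 1, by linarith, _, u, w, hs' _, hgt _ ⟨hσ.2.trans_lt (lt_add_one t), le_rfl⟩⟩
  have key : ∀ t, 0 < t → 0 < w t ∧ u 0 < u t := fun t ht =>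
    (hs' t).sol.w_pos_of_u_lt_one hβ.1 (by rwa [hs.init₂]) (by rw [hs.init₁]; exact hb.1)
      (fun x hx => hu x hx.1) t ⟨ht, le_rfl⟩
  refine ⟨u, w, hs, fun t ht => (hpos t ht).1, fun t ht => ⟨?_, hu t ht⟩, fun t ht => (key t ht).1⟩
  rw [← hs.init₁]
  rcases ht.eq_or_lt with h | h
  · rw [← h]
  · exact (key t h).2.le

lemma convex_of_not_exceedsOne {β a b c : ℝ} (hβ : β ∈ Ioc (0 : ℝ) 1) (ha : 0 ≤ a)
    (hb : b ∈ Ioo (0 : ℝ) 1) (hc : 0 ≤ c) (hD : ¬ ExceedsOne β a b c) :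
    SolvesBVP β a b 1 (maxSol β a b c) ∧ ConvexOn ℝ (Ici 0) (maxSol β a b c) := by
  obtain ⟨u, w, hs, hf, hu, hw⟩ := exists_convex_of_not_exceedsOne hβ ha hb hc hD
  refine ⟨⟨u, w, hs.sol, hs.init₀, hs.init₁, hs.sol.tendsto_one_of_w_nonneg hβ.1 zero_le_one hf
    (fun x hx => (hw x (by linarith)).le) (hb.1.trans_le (hu 1 zero_le_one).1)
    fun x hx => (hu x (by linarith)).2⟩, ?_⟩
  refine (hs.sol.strictConvexOn (convex_Ici _) le_rfl fun x hx => ?_).convexOn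
  rw [interior_Ici] at hx
  exact hw x hx

lemma ExceedsOne.lt {β a b c : ℝ} (hβ : β ∈ Ioc (0 : ℝ) 1) (hb : b ∈ Ioo (0 : ℝ) 1) (hc : 0 ≤ c)
    (hD : ExceedsOne β a b c) : a * (1 - b) < c := by
  by_contra! hle
  obtain ⟨t, ht, f, u, w, hs, hu⟩ := hD
  obtain ⟨σ, hσ, hσ1, -, hlt, -⟩ := hs.exists_hit_one hβ.2 hb.2 ⟨ht, le_rfl⟩ hu.le
  have := (hs.mono (Icc_subset_Icc_right hσ.2)).u_lt_one hβ.2 hb.2 hle (fun x hx => by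
    rcases hx.2.eq_or_lt with h | h
    · rw [h, hσ1]
      exact zero_le_one
    rcases hx.1.eq_or_lt with h0 | h0
    · rw [← h0, hs.init₁]
      exact hb.1.le
    have := ((hs.sol.mono (Icc_subset_Icc_right (h.le.trans hσ.2))).w_pos_of_u_lt_one hβ.1
      (by rwa [hs.init₂]) (by rw [hs.init₁]; exact hb.1)
      (fun y hy => hlt y ⟨hy.1, hy.2.trans_lt h⟩) x ⟨h0, le_rfl⟩).2
    rw [hs.init₁] at this
    linarith [hb.1]) σ ⟨hσ.1.le, le_rfl⟩
  linarith

/-- While `f'` grows from `b` to `1`, `f''` is positive. -/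
lemma IsIVPSolutionOn.w_pos_until_hit {β a b c σ : ℝ} {f u w : ℝ → ℝ} (hβ : 0 < β) (hb : 0 < b)
    (hc : 0 < c) (h : IsIVPSolutionOn β a b c (Icc 0 σ) f u w) (hwσ : 0 < w σ)
    (hlt : ∀ x ∈ Ico 0 σ, u x < 1) : ∀ x ∈ Icc 0 σ, 0 < w x := by
  intro x hx
  rcases hx.2.eq_or_lt with h1 | h1
  · rwa [h1]
  rcases hx.1.eq_or_lt with h0 | h0
  · rwa [← h0, h.init₂]
  exact ((h.sol.mono (Icc_subset_Icc_right h1.le)).w_pos_of_u_lt_one hβ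
    (by rw [h.init₂]; exact hc.le)
    (by rwa [h.init₁]) (fun y hy => hlt y ⟨hy.1, hy.2.trans_lt h1⟩) x ⟨h0, le_rfl⟩).1

lemma ExceedsOne.convexConcave {β a b c : ℝ} (hβ : β ∈ Ioc (0 : ℝ) 1) (ha : 0 ≤ a)
    (hb : b ∈ Ioo (0 : ℝ) 1) (hc : 0 < c) (hD : ExceedsOne β a b c) :
    SolvesBVP β a b 1 (maxSol β a b c) ∧ IsConvexConcave (maxSol β a b c) := by
  obtain ⟨u, w, hs, hpos⟩ := exists_global_of_nonneg hβ ha hb hc.le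
  have hs' : ∀ t, IsIVPSolutionOn β a b c (Icc 0 t) (maxSol β a b c) u w := fun t =>
    hs.mono Icc_subset_Ici_self
  obtain ⟨t, ht, f', u', w', hD', hut⟩ := hD
  rw [← ((hs' t).eq hD' ht le_rfl le_rfl).2.1] at hut
  obtain ⟨σ, hσ, hσ1, hwσ, hlt, -⟩ := (hs' t).exists_hit_one hβ.2 hb.2 ⟨ht, le_rfl⟩ hut.le
  have hgt : ∀ x, σ < x → 1 < u x := fun x hx =>
    ((hs' x).sol.mono (Icc_subset_Icc_left hσ.1.le)).one_lt_u hβ.2 hσ1 hwσ x ⟨hx, le_rfl⟩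
  have hwpos := (hs' σ).w_pos_until_hit hβ.1 hb.1 hc hwσ hlt
  -- `f''` cannot stay positive: `f'''` would be bounded above by a negative constant.
  obtain ⟨x, hxσ, hwx⟩ : ∃ x, σ < x ∧ w x ≤ 0 := by
    by_contra! hall
    have hη : 0 < u (σ + 1) - 1 := sub_pos.2 (hgt _ (lt_add_one σ))
    have hmono : ∀ x, σ + 1 ≤ x → u (σ + 1) ≤ u x := fun x hx => by
      rcases hx.eq_or_lt with h | h
      · rw [h]
      · exact ((hs' x).sol.mono (Icc_subset_Icc_left (by linarith [hσ.1]))).u_lt_of_w_pos h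
          (fun y hy => hall y ((lt_add_one σ).trans hy.1)) |>.le
    have hlim := tendsto_atTop_of_deriv_ge (s := σ + 1) (mul_pos hβ.1 hη)
      (fun x hx => ((hs.sol.hasDeriv₃ x (by simp only [mem_Ici]; linarith [hσ.1])).mono
        (Ici_subset_Ici.2 (by linarith [hσ.1]))).neg) fun x hx => by
        have h1 := hmono x hx
        have h2 := mul_nonneg (hpos x (by linarith [hσ.1])).1 (hall x (by linarith)).le
        have h3 : u (σ + 1) - 1 ≤ u x * (u x - 1) := by nlinarith
        have h4 := mul_le_mul_of_nonneg_left h3 hβ.1.le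
        linarith
    obtain ⟨x, hx, hxσ⟩ := ((hlim.eventually_ge_atTop 0).and (eventually_gt_atTop σ)).exists
    simp only [Pi.neg_apply] at hx
    linarith [hall x hxσ]
  have hx0 : 0 ≤ x := hσ.1.le.trans hxσ.le
  obtain ⟨τ, hτ, hτ0, hτlt⟩ := exists_first_hit (g := fun y => -w y) (k := 0) hx0
    (hs' x).sol.continuousOn_w.neg (by simpa [hs.init₂] using hc) (by simpa using hwx)
  have hτ0 : w τ = 0 := by simpa using hτ0
  have hτlt : ∀ y ∈ Ico 0 τ, 0 < w y := fun y hy => by simpa using hτlt y hy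
  have hστ : σ < τ := by
    by_contra! h
    exact (hwpos τ ⟨hτ.1.le, h⟩).ne' hτ0
  have hafter : ∀ y, τ < y → w y < 0 := fun y hy =>
    ((hs' y).sol.mono (Icc_subset_Icc_left hτ.1.le)).w_neg_of_pos hβ.1 hτ0.le (fun z hz => by
      have := hgt z (hστ.trans_le hz.1)
      exact mul_pos (by linarith) (by linarith)) y ⟨hy, le_rfl⟩
  refine ⟨⟨u, w, hs.sol, hs.init₀, hs.init₁, hs.sol.tendsto_one_of_w_nonpos hβ.1 hτ.1.le
    (fun x hx => (hpos x hx).1) (fun x hx => ?_) fun x hx => hgt x (hστ.trans_le hx)⟩,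
    τ, hτ.1, ?_, ?_⟩
  · rcases hx.eq_or_lt with h | h
    · rw [← h, hτ0]
    · exact (hafter x h).le
  · refine hs.sol.strictConvexOn (convex_Icc _ _) Icc_subset_Ici_self fun x hx => ?_
    rw [interior_Icc] at hx
    exact hτlt x ⟨hx.1.le, hx.2⟩
  · refine hs.sol.strictConcaveOn (convex_Ici _) (Ici_subset_Ici.2 hτ.1.le) fun x hx => ?_
    rw [interior_Ici] at hx
    exact hafter x hx

lemma exists_exceedsOne {β a b : ℝ} (hβ : β ∈ Ioc (0 : ℝ) 1) (ha : 0 ≤ a)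
    (hb : b ∈ Ioo (0 : ℝ) 1) : ∃ c, 0 ≤ c ∧ ExceedsOne β a b c := by
  -- For this `c`, `f''` stays above `1` on `[0, 1]` as long as `f' ≤ 1`.
  refine ⟨a + 2, by linarith, ?_⟩
  by_contra hD
  obtain ⟨u, w, hs, hf, hu, -⟩ := exists_convex_of_not_exceedsOne hβ ha hb (by linarith) hD
  -- `f'' + f (f' - 1)` has derivative at least `-1 / 4`.
  have hw : ∀ t ∈ Icc (0 : ℝ) 1, 1 ≤ w t := by
    intro t ht
    have := le_of_hasDerivWithinAt_nonneg (g' := fun x =>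
      u x * (u x - 1) - β * (u x * (u x - 1)) + 1 / 4 * 1) ht.1
      (fun x hx => ((hs.sol.hasDeriv_add_mul_sub 1 hx.1).mono Icc_subset_Ici_self).add
        ((hasDerivWithinAt_id x _).const_mul (1 / 4)))
      fun x hx => by
        have h0 := (hu x hx.1.le).1
        have h1 := (hu x hx.1.le).2
        nlinarith [mul_nonneg hβ.1.le (mul_nonneg (hb.1.le.trans h0) (sub_nonneg.2 h1.le)),
          sq_nonneg (u x - 1 / 2)]
    simp only [Pi.add_apply, id, hs.init₀, hs.init₁, hs.init₂] at this
    nlinarith [mul_nonneg (hf t ht.1) (sub_nonneg.2 (hu t ht.1).2.le), mul_nonneg ha hb.1.le, ht.2]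
  have := le_of_hasDerivWithinAt_nonneg (g := fun x => u x - 1 * x) (g' := fun x => w x - 1 * 1)
    zero_le_one (fun x hx => ((hs.sol.hasDeriv₂ x hx.1).mono Icc_subset_Ici_self).sub
      ((hasDerivWithinAt_id x _).const_mul 1))
    fun x hx => by linarith [hw x (Ioo_subset_Icc_self hx)]
  simp only [hs.init₁] at this
  linarith [(hu 1 zero_le_one).2, hb.1]

/-- If `f'` reaches `1` for `c₁` then it does so for `c₂ > c₁`: until then `f''` is bounded below
by its minimum along the first solution. -/
lemma ExceedsOne.mono {β a b c₁ c₂ : ℝ} (hβ : β ∈ Ioc (0 : ℝ) 1) (ha : 0 ≤ a)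
    (hb : b ∈ Ioo (0 : ℝ) 1) (hc₁ : 0 < c₁) (hc : c₁ < c₂) (hD : ExceedsOne β a b c₁) :
    ExceedsOne β a b c₂ := by
  by_contra hD₂
  obtain ⟨u₂, w₂, hs₂, -, hu₂, hw₂⟩ :=
    exists_convex_of_not_exceedsOne hβ ha hb (hc₁.trans hc).le hD₂
  obtain ⟨t, ht, f, u, w, hs, hu⟩ := hD
  obtain ⟨σ, hσ, hσ1, hwσ, hlt, -⟩ := hs.exists_hit_one hβ.2 hb.2 ⟨ht, le_rfl⟩ hu.le
  have hsσ := hs.mono (Icc_subset_Icc_right hσ.2)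
  have hw := hsσ.w_pos_until_hit hβ.1 hb.1 hc₁ hwσ hlt
  obtain ⟨x₀, hx₀, hmin⟩ := isCompact_Icc.exists_isMinOn ⟨0, le_rfl, hσ.1.le⟩
    hsσ.sol.continuousOn_w
  have hw₂' : ∀ x, 0 ≤ x → 0 < w₂ x := fun x hx => by
    rcases hx.eq_or_lt with h | h
    · rw [← h, hs₂.init₂]
      exact hc₁.trans hc
    · exact hw₂ x h
  have hlow : ∀ x, 0 ≤ x → w x₀ ≤ w₂ x := by
    intro x hx
    obtain ⟨t₁, ht₁, ht₁u⟩ := intermediate_value_Icc hσ.1.le hsσ.sol.continuousOn_u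
      (show u₂ x ∈ Icc (u 0) (u σ) by
        rw [hs.init₁, hσ1]
        exact ⟨(hu₂ x hx).1, (hu₂ x hx).2.le⟩)
    have h1 : w x₀ ≤ w t₁ := hmin ht₁
    exact h1.trans (w_lt_w_of_convex hb.1 hc ht₁.1 hx (hsσ.mono (Icc_subset_Icc_right ht₁.2))
      (hs₂.mono Icc_subset_Ici_self) (fun y hy => hw y ⟨hy.1, hy.2.trans ht₁.2⟩)
      (fun y hy => hw₂' y hy.1) ht₁u).le
  have hlim := tendsto_atTop_of_deriv_ge (hw x₀ hx₀) hs₂.sol.hasDeriv₂ hlow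
  obtain ⟨x, hx, hx0⟩ := ((hlim.eventually_gt_atTop 1).and (eventually_ge_atTop 0)).exists
  linarith [(hu₂ x hx0).2]

end MixedConvection

end

theorem mainTheorem2 (β a b : ℝ) (hβ : β ∈ Set.Ioc (0 : ℝ) 1) (ha : 0 ≤ a)
    (hb : b ∈ Set.Ioo (0 : ℝ) 1) :
    ∃ cLow cHigh : ℝ, cLow < 0 ∧ a * (1 - b) ≤ cHigh ∧
      (∀ c : ℝ, c < cLow → MixedConvection.maxTime β a b c < ⊤) ∧
      (MixedConvection.SolvesBVP β a b 0 (MixedConvection.maxSol β a b cLow) ∧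
        ConcaveOn ℝ (Set.Ici 0) (MixedConvection.maxSol β a b cLow)) ∧
      (∀ c ∈ Set.Ioo cLow 0,
        MixedConvection.SolvesBVP β a b 1 (MixedConvection.maxSol β a b c) ∧
          MixedConvection.IsConcaveConvex (MixedConvection.maxSol β a b c)) ∧
      (∀ c ∈ Set.Icc 0 cHigh,
        MixedConvection.SolvesBVP β a b 1 (MixedConvection.maxSol β a b c) ∧
          ConvexOn ℝ (Set.Ici 0) (MixedConvection.maxSol β a b c)) ∧
      (∀ c ∈ Set.Ioi cHigh,
        MixedConvection.SolvesBVP β a b 1 (MixedConvection.maxSol β a b c) ∧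
          MixedConvection.IsConvexConcave (MixedConvection.maxSol β a b c)) := by
  open MixedConvection in
  set A := {c : ℝ | c < 0 ∧ ReachesNegativeU β a b c} with hA
  set D := {c : ℝ | 0 ≤ c ∧ ExceedsOne β a b c} with hD
  have hAne : A.Nonempty := by
    obtain ⟨c, hc, h⟩ := exists_reachesNegativeU hβ ha hb
    exact ⟨c, hc, h⟩
  have hDne : D.Nonempty := exists_exceedsOne hβ ha hb
  have hab : 0 ≤ a * (1 - b) := mul_nonneg ha (sub_nonneg.2 hb.2.le)
  -- `A` stays away from `0` because the solution for `c = 0` has `f'' > 0` at once.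
  obtain ⟨δ, hδ, hAδ⟩ : ∃ δ < 0, ∀ c ∈ A, c ≤ δ := by
    obtain ⟨δ, hδ, h⟩ := mem_nhdsLT_iff_exists_Ioo_subset.1
      ((reachesPositiveW_zero hβ ha hb).eventually.filter_mono nhdsWithin_le_nhds)
    refine ⟨δ, hδ, fun c hc => ?_⟩
    by_contra! hlt
    exact hc.2.not_reachesPositiveW hβ ha hb hc.1 (h ⟨hlt, hc.1⟩)
  have hAbdd : BddAbove A := ⟨δ, hAδ⟩
  have hDbdd : BddBelow D := ⟨0, fun c hc => hc.1⟩
  have hlow : sSup A < 0 := (csSup_le hAne hAδ).trans_lt hδ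
  have hhigh : a * (1 - b) ≤ sInf D := le_csInf hDne fun c hc => (hc.2.lt hβ hb hc.1).le
  have hbelow : ∀ c, c < sSup A → ReachesNegativeU β a b c := fun c hc => by
    obtain ⟨c', hc', hlt⟩ := exists_lt_of_lt_csSup hAne hc
    exact reachesNegativeU_of_lt hβ ha hb hlt hc'.1
      (hc'.2.not_reachesPositiveW hβ ha hb hc'.1)
  have hAlow : ¬ ReachesNegativeU β a b (sSup A) := fun h => by
    obtain ⟨c, hc, hc'⟩ := ((h.eventually.filter_mono nhdsWithin_le_nhds).and
      (Ioo_mem_nhdsGT hlow)).exists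
    exact absurd (le_csSup hAbdd ⟨hc'.2, hc⟩) (not_le.2 hc'.1)
  have hBlow : ¬ ReachesPositiveW β a b (sSup A) := fun h => by
    obtain ⟨c, hc, hc'⟩ := ((h.eventually.filter_mono nhdsWithin_le_nhds).and
      (self_mem_nhdsWithin (s := Iio (sSup A)))).exists
    exact (hbelow c hc').not_reachesPositiveW hβ ha hb (lt_trans hc' hlow) hc
  refine ⟨sSup A, sInf D, hlow, hhigh, fun c hc => ?_, ?_, fun c hc => ?_, fun c hc => ?_,
    fun c hc => ?_⟩
  · exact (hbelow c hc).maxTime_lt_top hβ ha hb (hc.trans hlow)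
  · obtain ⟨u, w, hs, hw, hlim⟩ := exists_concave_of_not_reaches hβ ha hb hlow hAlow hBlow
    exact ⟨⟨u, w, hs.sol, hs.init₀, hs.init₁, hlim⟩,
      (hs.sol.strictConcaveOn (convex_Ici _) le_rfl fun x hx =>
        hw x (interior_subset hx)).concaveOn⟩
  · refine ReachesPositiveW.concaveConvex hβ ha hb hc.2 ?_
    by_contra hB
    exact hAlow (reachesNegativeU_of_lt hβ ha hb hc.1 hc.2 hB)
  · refine convex_of_not_exceedsOne hβ ha hb hc.1 fun h => ?_
    rcases hc.2.eq_or_lt with heq | hlt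
    · have hc0 : 0 < c := hab.trans_lt (h.lt hβ hb hc.1)
      obtain ⟨c', hc', hc''⟩ := ((h.eventually.filter_mono nhdsWithin_le_nhds).and
        (Ioo_mem_nhdsLT hc0)).exists
      exact absurd (csInf_le hDbdd ⟨hc''.1.le, hc'⟩) (not_le.2 (heq ▸ hc''.2))
    · exact absurd (csInf_le hDbdd ⟨hc.1, h⟩) (not_le.2 hlt)
  · obtain ⟨c', hc', hlt⟩ := exists_lt_of_csInf_lt hDne hc
    have hc0 : 0 < c' := hab.trans_lt (hc'.2.lt hβ hb hc'.1)
    exact (hc'.2.mono hβ ha hb hc0 hlt).convexConcave hβ ha hb (hc0.trans hlt)
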